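/- Let $d\ge 0$ and let $H=H(p,x):\mathbb R^d\times\mathbb R^d\to\mathbb R$ be continuous, convex in $p$ for every $x$, and such that $\underline\nu(|p|)\le H(p,x)\le\overline\nu(|p|)$ for all $(p,x)$, where $\underline\nu,\overline\nu:[0,\infty)\to\mathbb R$ are convex and increasing ($\underline\nu$ strictly). For a continuous path $\zeta:[0,\infty)\to\mathbb R$ consider $$u_t=H(Du,x)\,\dot\zeta\ \text{ in }\mathbb R^d\times(0,\infty),\qquad u(\cdot,0)=u_0 .\tag{1}$$ For piecewise $C^1$ paths, a solution of (1) is a continuous function on $\mathbb R^d\times[0,\infty)$ that is a viscosity solution on $\mathbb R^d\times I$ for every open interval $I$ of $(0,\infty)$ on which $\zeta$ is $C^1$, attains the initial data, and satisfies $|u(x,t)|\le C_T(1+|x|)$ on $\mathbb R^d\times[0,T]$ for every $T$. Write $a_-=\max(-a,0)$. Spaces of continuous functions carry the topology of locally uniform convergence. (a) Let $\zeta^1,\zeta^2$ be piecewise $C^1$, let $u_0^1,u_0^2$ be Lipschitz with constant $L\ge 0$, and let $u^1,u^2$ be the corresponding solutions. Then $\|Du^j(\cdot,t)\|_\infty\le\underline\nu^{-1}(\overline\nu(L))$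 for all $t\ge0$ and $j=1,2$. If moreover $\zeta^1(0)=\zeta^2(0)$, then, for every $T\ge0$, with $M_T=\max_{[0,T]}|\zeta^1-\zeta^2|$, and for all $(x,t)\in\mathbb R^d\times[0,T]$, $$u^1(x,t)-u^2(x,t)\le \sup_{\mathbb R^d}|u_0^1-u_0^2|+\overline\nu(L)\,M_T+\underline\nu(0)_-\bigl(M_T-(\zeta^1(t)-\zeta^2(t))\bigr),$$ and consequently $$|u^1(x,t)-u^2(x,t)|\le \sup_{\mathbb R^d}|u_0^1-u_0^2|+\overline\nu(L)\,M_T+\underline\nu(0)_-\bigl(M_T+|\zeta^1(t)-\zeta^2(t)|\bigr).$$ (b) For every uniformly continuous $u_0$, there is a unique continuous map $S_{u_0}:C([0,\infty))\to C(\mathbb R^d\times[0,\infty))$ such that $S_{u_0}(\zeta)$ is a solution of (1) for every $\zeta\in C^1([0,\infty))$; moreover, for every piecewise $C^1$ path $\zeta$, $S_{u_0}(\zeta)$ is the unique solution of (1). (c) If $u_0$ is Lipschitz with constant $L$, then $\|D_xS_{u_0}(\zeta)(\cdot,t)\|_\infty\le\underline\nu^{-1}(\overline\nu(L))$ for all continuous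 $\zeta$ and all $t\ge0$, and, for all continuous $\zeta_1,\zeta_2$ and all $T\ge0$, $$\sup_{\mathbb R^d\times[0,T]}|S_{u_0}(\zeta_1)-S_{u_0}(\zeta_2)|\le 2\bigl(\overline\nu(L)+2\,\underline\nu(0)_-\bigr)\max_{[0,T]}|\zeta_1-\zeta_2| .$$ -/

import Mathlib

open scoped NNReal

/-- Euclidean space `ℝ^d`. -/
abbrev Space (d : ℕ) : Type := EuclideanSpace ℝ (Fin d)

/-- `H(p, x)` is continuous, convex in `p`, and lies between `νl(|p|)` and `νu(|p|)`, where `νl` and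
`νu` are convex and increasing on `[0, ∞)`. The lower function is strictly increasing, so that it
has an inverse; for the upper one monotonicity suffices. -/
structure IsConvexCoerciveHamiltonian {d : ℕ} (H : Space d → Space d → ℝ) (νl νu : ℝ → ℝ) :
    Prop where
  continuous_uncurry : Continuous fun q : Space d × Space d => H q.1 q.2
  convex : ∀ x, ConvexOn ℝ Set.univ fun p => H p x
  lower_convex : ConvexOn ℝ (Set.Ici 0) νl
  lower_strictMono : StrictMonoOn νl (Set.Ici 0)
  upper_convex : ConvexOn ℝ (Set.Ici 0) νu
  upper_mono : MonotoneOn νu (Set.Ici 0)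
  lower_le : ∀ p x, νl ‖p‖ ≤ H p x
  le_upper : ∀ p x, H p x ≤ νu ‖p‖

/-- A path on `[0, ∞)`, extended to `ℝ` by its initial value on `(-∞, 0)`. Only its behaviour on
`[0, ∞)` is ever used. -/
def pathExt (ζ : C(ℝ≥0, ℝ)) (t : ℝ) : ℝ := ζ t.toNNReal

/-- `ζ ∈ C¹([0, ∞))`, with a one-sided derivative at `0`. -/
def IsC1Path (ζ : C(ℝ≥0, ℝ)) : Prop := ContDiffOn ℝ 1 (pathExt ζ) (Set.Ici 0)

/-- `ζ` is continuous and piecewise `C¹` on `[0, ∞)`: every `t ≥ 0` has a right neighbourhood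
`[t, t + ε]` and, if `t > 0`, a left neighbourhood `[t - ε, t]` on which `ζ` is `C¹` up to the end
points. By compactness this says that every `[0, T]` splits into finitely many intervals on each of
which `ζ` is `C¹` up to the end points. -/
def IsPiecewiseC1Path (ζ : C(ℝ≥0, ℝ)) : Prop :=
  ∀ t : ℝ, 0 ≤ t → ∃ ε > 0, ContDiffOn ℝ 1 (pathExt ζ) (Set.Icc t (t + ε)) ∧
    (0 < t → ContDiffOn ℝ 1 (pathExt ζ) (Set.Icc (t - ε) t))

/-- Viscosity sub-solution of `u_t = H(Du, x) ζ'(t)` in `ℝ^d × (0, ∞)`. The equation is tested at the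
times near which `ζ` is `C¹`: all positive times for a `C¹` path, all positive times off the break
points for a piecewise `C¹` path. -/
def IsViscositySubsolution {d : ℕ} (H : Space d → Space d → ℝ) (ζ : C(ℝ≥0, ℝ))
    (u : C(Space d × ℝ≥0, ℝ)) : Prop :=
  ∀ φ : Space d × ℝ → ℝ, ContDiff ℝ 1 φ → ∀ (x : Space d) (t : ℝ), 0 < t →
    ContDiffAt ℝ 1 (pathExt ζ) t →
    IsLocalMax (fun q : Space d × ℝ => u (q.1, q.2.toNNReal) - φ q) (x, t) →
    deriv (fun s => φ (x, s)) t ≤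
      H (gradient (fun y => φ (y, t)) x) x * deriv (pathExt ζ) t

/-- Viscosity super-solution of `u_t = H(Du, x) ζ'(t)` in `ℝ^d × (0, ∞)`. -/
def IsViscositySupersolution {d : ℕ} (H : Space d → Space d → ℝ) (ζ : C(ℝ≥0, ℝ))
    (u : C(Space d × ℝ≥0, ℝ)) : Prop :=
  ∀ φ : Space d × ℝ → ℝ, ContDiff ℝ 1 φ → ∀ (x : Space d) (t : ℝ), 0 < t →
    ContDiffAt ℝ 1 (pathExt ζ) t →
    IsLocalMin (fun q : Space d × ℝ => u (q.1, q.2.toNNReal) - φ q) (x, t) →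
    H (gradient (fun y => φ (y, t)) x) x * deriv (pathExt ζ) t ≤
      deriv (fun s => φ (x, s)) t

/-- `u` is a (continuous) viscosity solution of `u_t = H(Du, x) ζ'` in `ℝ^d × (0, ∞)` with
`u(·, 0) = u₀`, in the usual class of functions of at most linear growth in space, locally uniformly
in time (every function that is uniformly continuous on each `ℝ^d × [0, T]` belongs to it). -/
structure IsViscositySolution {d : ℕ} (H : Space d → Space d → ℝ) (ζ : C(ℝ≥0, ℝ))
    (u₀ : Space d → ℝ) (u : C(Space d × ℝ≥0, ℝ)) : Prop where
  subsolution : IsViscositySubsolution H ζ u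
  supersolution : IsViscositySupersolution H ζ u
  initial : ∀ x, u (x, 0) = u₀ x
  linear_growth : ∀ T : ℝ≥0, ∃ C : ℝ, ∀ x, ∀ t ≤ T, |u (x, t)| ≤ C * (1 + ‖x‖)

/-- `S : C([0, ∞)) → C(ℝ^d × [0, ∞))` is a continuous extension (both spaces carry the topology of
locally uniform convergence) of the solution operator of `u_t = H(Du, x) ζ'`, `u(·, 0) = u₀`, from
`C¹` paths to continuous paths. -/
def IsSolutionOperator {d : ℕ} (H : Space d → Space d → ℝ) (u₀ : Space d → ℝ)
    (S : C(ℝ≥0, ℝ) → C(Space d × ℝ≥0, ℝ)) : Prop :=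
  Continuous S ∧ ∀ ζ, IsC1Path ζ → IsViscositySolution H ζ u₀ (S ζ)

/-- `max_{t ∈ [0, T]} |ζ¹(t) - ζ²(t)|`. -/
noncomputable def pathDist (T : ℝ≥0) (ζ₁ ζ₂ : C(ℝ≥0, ℝ)) : ℝ :=
  sSup ((fun t => |ζ₁ t - ζ₂ t|) '' Set.Icc 0 T)

/-!
For a fixed Hamiltonian, `u_t = H(Du, x)` and `u_t = -H(Du, x)` are solved by a pair of
Lax–Oleinik semigroups, `forwardFlow` and `backwardFlow`: optimization over polygonal paths whose
cost per unit time is a number `b` with `⟪q, p⟫ - b ≤ H(p, ·)` along the segment of velocity `q`.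
Both preserve the class of functions `u` with `u(y) - u(x) ≤ κ + c t` for every path of cost `κ`
from `x` to `y` in time `t`. This class plays the role of the inequality `H(Du, x) ≤ c`: it contains
the `L`-Lipschitz functions when `c = νu(L)` and consists of `K`-Lipschitz functions when
`c = νl(K)`. On it the backward flow followed by the forward flow for the same time does not
increase a function, and the opposite order does not decrease it.

For a piecewise linear path the two semigroups are composed. A non-negative increment of the path
has a larger effect when it is made first than when it is made last. So if `α 0 = β 0` and
`α - β ≤ M`, the flow along `α` followed by the increment that ends at `β + M` stays below the flow
along `β` started with the increment `M`. Those two increments change a function by at most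
`(νl 0)⁻ (M - (α - β))` downwards and `νu(L) M` upwards, which is the estimate in the maximum norm.
It extends the flow from dyadic interpolations to all continuous paths. The resulting function is a
viscosity solution where the path is smooth, and a comparison principle, proved by doubling of
variables and propagated across the break points, identifies it with every solution.
-/

open Filter Topology

section MomentumFlip

variable {E : Type*} [NormedAddCommGroup E] {H : E → E → ℝ}

/-- The Hamiltonian `H(-p, x)`: if `u` solves the equation with `H` along `ζ`, then `-u` solves the
equation with `H(-p, x)` along `-ζ`. -/
def momentumFlip (H : E → E → ℝ) : E → E → ℝ := fun p => H (-p)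

@[simp] lemma momentumFlip_momentumFlip (H : E → E → ℝ) : momentumFlip (momentumFlip H) = H := by
  funext p
  simp only [momentumFlip, neg_neg]

lemma neg_le_momentumFlip {m : ℝ} (hm : ∀ p x, -m ≤ H p x) (p x : E) : -m ≤ momentumFlip H p x :=
  hm (-p) x

end MomentumFlip

section Chains

variable {E : Type*} [NormedAddCommGroup E] [InnerProductSpace ℝ E]

/-- The straight move from `x` to `y` with velocity `q` has running cost `b`: the affine function
`p ↦ ⟪q, p⟫ - b` lies below `H(·, z)` for all `z` in the segment. This replaces the Lagrangian of
`H` along the move by an upper bound that does not depend on `z`. -/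
def Admissible (H : E → E → ℝ) (q : E) (b : ℝ) (x y : E) : Prop :=
  ∀ z ∈ segment ℝ x y, ∀ p, inner ℝ q p - b ≤ H p z

/-- `Reach H t x y κ`: finitely many admissible straight moves lead from `x` to `y` in time `t` at
total cost `κ`. -/
inductive Reach (H : E → E → ℝ) : ℝ → E → E → ℝ → Prop
  | refl (x : E) : Reach H 0 x x 0
  | step {t x y κ} (h : Reach H t x y κ) (s : ℝ) (q : E) (b : ℝ) (hs : 0 ≤ s)
      (ha : Admissible H q b y (y + s • q)) : Reach H (t + s) x (y + s • q) (κ + s * b)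

variable {H : E → E → ℝ} {x y z q : E} {b s t κ κ' : ℝ}

lemma add_smul_mem_segment {r : ℝ} (hr : 0 ≤ r) (hrs : r ≤ s) (x q : E) :
    x + r • q ∈ segment ℝ x (x + s • q) := by
  rcases (hr.trans hrs).eq_or_lt with rfl | hs
  · obtain rfl := le_antisymm hrs hr
    exact right_mem_segment ..
  · have hmem := (convex_segment x (x + s • q)).add_smul_mem (left_mem_segment ..)
      (right_mem_segment ..) ⟨div_nonneg hr hs.le, (div_le_one hs).2 hrs⟩
    rwa [smul_smul, div_mul_cancel₀ _ hs.ne'] at hmem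

namespace Admissible

lemma mono {x' y' : E} (h : Admissible H q b x y) (hx : x' ∈ segment ℝ x y)
    (hy : y' ∈ segment ℝ x y) : Admissible H q b x' y' :=
  fun z hz => h z ((convex_segment x y).segment_subset hx hy hz)

lemma reverse (h : Admissible H q b x y) : Admissible (momentumFlip H) (-q) b y x := by
  intro z hz p
  simpa only [momentumFlip, inner_neg_left, inner_neg_right] using
    h z (segment_symm ℝ x y ▸ hz) (-p)

end Admissible

namespace Reach

lemma time_nonneg (h : Reach H t x y κ) : 0 ≤ t := by
  induction h with
  | refl => exact le_rfl
  | step _ _ _ _ hs _ ih => exact add_nonneg ih hs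

lemma congr {t' : ℝ} {y' : E} (h : Reach H t x y κ) (ht : t = t') (hy : y = y') (hκ : κ = κ') :
    Reach H t' x y' κ' := by
  subst ht hy hκ
  exact h

lemma single (hs : 0 ≤ s) (ha : Admissible H q b x (x + s • q)) :
    Reach H s x (x + s • q) (s * b) :=
  (Reach.step (.refl x) s q b hs ha).congr (zero_add _) rfl (zero_add _)

lemma trans (h : Reach H t x y κ) (h' : Reach H s y z κ') : Reach H (t + s) x z (κ + κ') := by
  induction h' with
  | refl => exact h.congr (add_zero _).symm rfl (add_zero _).symm
  | step _ s q b hs ha ih => exact ((ih h).step s q b hs ha).congr (by ring) rfl (by ring)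

lemma split (h : Reach H t x z κ) {r : ℝ} (hr : 0 ≤ r) (hrt : r ≤ t) :
    ∃ y κ₁ κ₂, Reach H r x y κ₁ ∧ Reach H (t - r) y z κ₂ ∧ κ = κ₁ + κ₂ := by
  induction h with
  | refl x =>
    obtain rfl : r = 0 := le_antisymm hrt hr
    exact ⟨x, 0, 0, .refl x, (Reach.refl x).congr (by ring) rfl rfl, by ring⟩
  | @step t x y κ h s q b hs ha ih =>
    rcases le_or_gt r t with hrt' | htr
    · obtain ⟨w, κ₁, κ₂, h₁, h₂, rfl⟩ := ih hrt'
      exact ⟨w, κ₁, κ₂ + s * b, h₁, (h₂.step s q b hs ha).congr (by ring) rfl rfl, by ring⟩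
    · have hend : y + (r - t) • q + (s - (r - t)) • q = y + s • q := by module
      have hmid : y + (r - t) • q ∈ segment ℝ y (y + s • q) :=
        add_smul_mem_segment (by linarith) (by linarith) y q
      have hfirst : Admissible H q b y (y + (r - t) • q) := ha.mono (left_mem_segment ..) hmid
      have hsecond : Admissible H q b (y + (r - t) • q) (y + (r - t) • q + (s - (r - t)) • q) :=
        hend ▸ ha.mono hmid (right_mem_segment ..)
      exact ⟨y + (r - t) • q, κ + (r - t) * b, (s - (r - t)) * b,
        (h.step _ q b (by linarith) hfirst).congr (by ring) rfl rfl,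
        (Reach.single (by linarith) hsecond).congr (by ring) hend rfl, by ring⟩

lemma reverse (h : Reach H t x y κ) : Reach (momentumFlip H) t y x κ := by
  induction h with
  | refl x => exact .refl x
  | @step t x y κ _ s q b hs ha ih =>
    have hback : y + s • q + s • (-q) = y := by module
    have hmove : Admissible (momentumFlip H) (-q) b (y + s • q) (y + s • q + s • (-q)) := by
      rw [hback]
      exact ha.reverse
    exact (((Reach.single hs hmove).congr rfl hback rfl).trans ih).congr (by ring) rfl (by ring)

lemma of_momentumFlip (h : Reach (momentumFlip H) t x y κ) : Reach H t y x κ := by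
  simpa only [momentumFlip_momentumFlip] using h.reverse

lemma eq_of_time_eq_zero (h : Reach H t x y κ) (ht : t = 0) : y = x ∧ κ = 0 := by
  induction h with
  | refl x => exact ⟨rfl, rfl⟩
  | @step t x y κ h s q b hs ha ih =>
    have ht₀ := h.time_nonneg
    obtain rfl : s = 0 := by linarith
    obtain ⟨rfl, rfl⟩ := ih (by linarith)
    simp only [zero_smul, add_zero, zero_mul, and_self]

end Reach

lemma reach_self {m : ℝ} (hm : ∀ p x, -m ≤ H p x) (ht : 0 ≤ t) (x : E) :
    Reach H t x x (m * t) := by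
  have hrest : Admissible H 0 m x (x + t • 0) := fun z _ p => by
    simpa only [inner_zero_left, zero_sub] using hm p z
  exact (Reach.single ht hrest).congr rfl (by rw [smul_zero, add_zero]) (mul_comm _ _)

end Chains

section Semigroups

variable {E : Type*} [NormedAddCommGroup E] [InnerProductSpace ℝ E]

/-- `u` grows at most by the cost plus `c` times the duration along every chain of moves; this
encodes `H(Du, x) ≤ c` without derivatives. -/
def CostDominated (H : E → E → ℝ) (c : ℝ) (u : E → ℝ) : Prop :=
  ∀ ⦃t x y κ⦄, Reach H t x y κ → u y - u x ≤ κ + c * t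

/-- The forward semigroup, which solves `u_t = H(Du, x)` by the optimal control formula. -/
noncomputable def forwardFlow (H : E → E → ℝ) (t : ℝ) (u : E → ℝ) : E → ℝ :=
  fun x => sSup {r | ∃ y κ, Reach H t x y κ ∧ r = u y - κ}

/-- The backward semigroup, which solves `u_t = -H(Du, x)`. -/
noncomputable def backwardFlow (H : E → E → ℝ) (t : ℝ) (u : E → ℝ) : E → ℝ :=
  -forwardFlow (momentumFlip H) t (-u)

variable {H : E → E → ℝ} {m c t κ B D : ℝ} {u v : E → ℝ} {x y : E}

lemma forwardFlow_zero (u : E → ℝ) : forwardFlow H 0 u = u := by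
  funext x
  have hset : {r | ∃ y κ, Reach H 0 x y κ ∧ r = u y - κ} = {u x} := by
    ext r
    constructor
    · rintro ⟨y, κ, h, rfl⟩
      obtain ⟨rfl, rfl⟩ := h.eq_of_time_eq_zero rfl
      exact sub_zero _
    · rintro rfl
      exact ⟨x, 0, .refl x, (sub_zero _).symm⟩
  rw [forwardFlow, hset, csSup_singleton]

lemma backwardFlow_zero (u : E → ℝ) : backwardFlow H 0 u = u := by
  rw [backwardFlow, forwardFlow_zero, neg_neg]

lemma forwardFlow_le (hm : ∀ p x, -m ≤ H p x) (ht : 0 ≤ t)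
    (h : ∀ y κ, Reach H t x y κ → u y - κ ≤ B) : forwardFlow H t u x ≤ B := by
  refine csSup_le ⟨_, x, _, reach_self hm ht x, rfl⟩ ?_
  rintro _ ⟨y, κ, hr, rfl⟩
  exact h y κ hr

lemma exists_lt_of_lt_forwardFlow (hm : ∀ p x, -m ≤ H p x) (ht : 0 ≤ t)
    (h : B < forwardFlow H t u x) : ∃ y κ, Reach H t x y κ ∧ B < u y - κ := by
  by_contra! hle
  exact (forwardFlow_le hm ht hle).not_gt h

namespace CostDominated

lemma neg (hu : CostDominated H c u) : CostDominated (momentumFlip H) c (-u) := by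
  intro t x y κ h
  simp only [Pi.neg_apply]
  linarith [hu h.of_momentumFlip]

lemma add_const (hu : CostDominated H c u) (D : ℝ) : CostDominated H c (fun x => u x + D) := by
  intro t x y κ h
  linarith [hu h]

lemma weaken {c' : ℝ} (hu : CostDominated H c u) (h : c ≤ c') : CostDominated H c' u := by
  intro t x y κ hr
  linarith [hu hr, mul_le_mul_of_nonneg_right h hr.time_nonneg]

lemma le_forwardFlow (hu : CostDominated H c u) (h : Reach H t x y κ) :
    u y - κ ≤ forwardFlow H t u x := by
  refine le_csSup ⟨u x + c * t, ?_⟩ ⟨y, κ, h, rfl⟩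
  rintro _ ⟨y, κ, h, rfl⟩
  linarith [hu h]

lemma backwardFlow_le (hu : CostDominated H c u) (h : Reach H t x y κ) :
    backwardFlow H t u y ≤ u x + κ := by
  have := hu.neg.le_forwardFlow h.reverse
  simp only [backwardFlow, Pi.neg_apply] at this ⊢
  linarith

protected lemma forwardFlow (hm : ∀ p x, -m ≤ H p x) (hu : CostDominated H c u) (ht : 0 ≤ t) :
    CostDominated H c (forwardFlow H t u) := by
  intro s x y κ h
  rw [sub_le_iff_le_add]
  refine forwardFlow_le hm ht fun z κ' h' => ?_
  obtain ⟨w, κ₁, κ₂, h₁, h₂, hκ⟩ := (h.trans h').split ht (by linarith [h.time_nonneg])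
  have htail := hu h₂
  rw [add_sub_cancel_right] at htail
  linarith [hu.le_forwardFlow h₁]

protected lemma backwardFlow (hm : ∀ p x, -m ≤ H p x) (hu : CostDominated H c u) (ht : 0 ≤ t) :
    CostDominated H c (backwardFlow H t u) := by
  simpa only [_root_.backwardFlow, momentumFlip_momentumFlip] using
    (hu.neg.forwardFlow (neg_le_momentumFlip hm) ht).neg

lemma forwardFlow_add (hm : ∀ p x, -m ≤ H p x) (hu : CostDominated H c u) {s : ℝ} (hs : 0 ≤ s)
    (ht : 0 ≤ t) : forwardFlow H (s + t) u = forwardFlow H s (forwardFlow H t u) := by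
  funext x
  refine le_antisymm (forwardFlow_le hm (add_nonneg hs ht) fun y κ h => ?_)
    (forwardFlow_le hm hs fun y κ h => ?_)
  · obtain ⟨w, κ₁, κ₂, h₁, h₂, rfl⟩ := h.split hs (by linarith)
    have htail := hu.le_forwardFlow (h₂.congr (add_sub_cancel_left s t) rfl rfl)
    linarith [(hu.forwardFlow hm ht).le_forwardFlow h₁]
  · rw [sub_le_iff_le_add]
    exact forwardFlow_le hm ht fun z κ' h' => by linarith [hu.le_forwardFlow (h.trans h')]

lemma backwardFlow_add (hm : ∀ p x, -m ≤ H p x) (hu : CostDominated H c u) {s : ℝ} (hs : 0 ≤ s)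
    (ht : 0 ≤ t) : backwardFlow H (s + t) u = backwardFlow H s (backwardFlow H t u) := by
  simp only [backwardFlow, hu.neg.forwardFlow_add (neg_le_momentumFlip hm) hs ht, neg_neg]

lemma forwardFlow_le_forwardFlow_add (hm : ∀ p x, -m ≤ H p x) (hv : CostDominated H c v)
    (ht : 0 ≤ t) (h : ∀ x, u x ≤ v x + D) (x : E) :
    forwardFlow H t u x ≤ forwardFlow H t v x + D :=
  forwardFlow_le hm ht fun y κ hr => by linarith [hv.le_forwardFlow hr, h y]

lemma backwardFlow_le_backwardFlow_add (hm : ∀ p x, -m ≤ H p x) (hu : CostDominated H c u)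
    (ht : 0 ≤ t) (h : ∀ x, u x ≤ v x + D) (x : E) :
    backwardFlow H t u x ≤ backwardFlow H t v x + D := by
  have := hu.neg.forwardFlow_le_forwardFlow_add (neg_le_momentumFlip hm) (u := -v) (D := D) ht
    (fun x => by simp only [Pi.neg_apply]; linarith [h x]) x
  simp only [backwardFlow, Pi.neg_apply]
  linarith

lemma forwardFlow_mono (hm : ∀ p x, -m ≤ H p x) (hv : CostDominated H c v) (ht : 0 ≤ t)
    (h : u ≤ v) : forwardFlow H t u ≤ forwardFlow H t v := fun x => by
  simpa only [add_zero] using hv.forwardFlow_le_forwardFlow_add hm (D := 0) ht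
    (fun y => by simpa only [add_zero] using h y) x

lemma forwardFlow_le_add (hm : ∀ p x, -m ≤ H p x) (hu : CostDominated H c u) (ht : 0 ≤ t)
    (x : E) : forwardFlow H t u x ≤ u x + c * t :=
  forwardFlow_le hm ht fun y κ hr => by linarith [hu hr]

lemma le_forwardFlow_add (hm : ∀ p x, -m ≤ H p x) (hu : CostDominated H c u) (ht : 0 ≤ t)
    (x : E) : u x ≤ forwardFlow H t u x + m * t := by
  linarith [hu.le_forwardFlow (reach_self hm ht x)]

lemma forwardFlow_backwardFlow_le (hm : ∀ p x, -m ≤ H p x) (hu : CostDominated H c u)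
    (ht : 0 ≤ t) : forwardFlow H t (backwardFlow H t u) ≤ u := fun _ =>
  forwardFlow_le hm ht fun y κ hr => by linarith [hu.backwardFlow_le hr]

end CostDominated

end Semigroups

section DiscreteFlow

variable {E : Type*} [NormedAddCommGroup E] [InnerProductSpace ℝ E]

/-- The effect on `u` of an increment `a` of the driving path. -/
noncomputable def flowStep (H : E → E → ℝ) (a : ℝ) (u : E → ℝ) : E → ℝ :=
  if 0 ≤ a then forwardFlow H a u else backwardFlow H (-a) u

/-- The flow along the piecewise linear path with successive values `a 0, a 1, …`, after `n`
increments. -/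
noncomputable def discreteFlow (H : E → E → ℝ) (a : ℕ → ℝ) : ℕ → (E → ℝ) → E → ℝ
  | 0, u => u
  | n + 1, u => flowStep H (a (n + 1) - a n) (discreteFlow H a n u)

variable {H : E → E → ℝ} {m c a b D M : ℝ} {u v : E → ℝ} {α β : ℕ → ℝ} {k n : ℕ}

lemma flowStep_of_nonneg (ha : 0 ≤ a) (u : E → ℝ) : flowStep H a u = forwardFlow H a u :=
  if_pos ha

lemma flowStep_zero (u : E → ℝ) : flowStep H 0 u = u := by
  rw [flowStep_of_nonneg le_rfl, forwardFlow_zero]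

lemma flowStep_of_nonpos (ha : a ≤ 0) (u : E → ℝ) : flowStep H a u = backwardFlow H (-a) u := by
  rcases ha.eq_or_lt with rfl | h
  · rw [flowStep_zero, neg_zero, backwardFlow_zero]
  · exact if_neg h.not_ge

lemma flowStep_momentumFlip (a : ℝ) (u : E → ℝ) :
    flowStep (momentumFlip H) (-a) (-u) = -flowStep H a u := by
  rcases le_total 0 a with ha | ha
  · rw [flowStep_of_nonpos (neg_nonpos.2 ha), flowStep_of_nonneg ha, backwardFlow,
      momentumFlip_momentumFlip, neg_neg, neg_neg]
  · rw [flowStep_of_nonpos ha, flowStep_of_nonneg (neg_nonneg.2 ha), backwardFlow, neg_neg]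

lemma discreteFlow_momentumFlip (α : ℕ → ℝ) (n : ℕ) (u : E → ℝ) :
    discreteFlow (momentumFlip H) (-α) n (-u) = -discreteFlow H α n u := by
  induction n with
  | zero => rfl
  | succ n ih =>
    rw [discreteFlow, ih, discreteFlow, ← flowStep_momentumFlip, Pi.neg_apply, Pi.neg_apply,
      neg_sub_neg, neg_sub]

lemma discreteFlow_congr (h : ∀ k ≤ n, α k = β k) (u : E → ℝ) :
    discreteFlow H α n u = discreteFlow H β n u := by
  induction n with
  | zero => rfl
  | succ n ih =>
    rw [discreteFlow, discreteFlow, ih fun k hk => h k (hk.trans n.le_succ), h n n.le_succ,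
      h (n + 1) le_rfl]

lemma discreteFlow_of_const_tail (hkn : k ≤ n) (h : ∀ i, k ≤ i → α i = α k) (u : E → ℝ) :
    discreteFlow H α n u = discreteFlow H α k u := by
  induction n, hkn using Nat.le_induction with
  | base => rfl
  | succ n hkn ih => rw [discreteFlow, h _ (hkn.trans n.le_succ), h n hkn, sub_self,
      flowStep_zero, ih]

namespace CostDominated

protected lemma flowStep (hm : ∀ p x, -m ≤ H p x) (hu : CostDominated H c u) (a : ℝ) :
    CostDominated H c (flowStep H a u) := by
  rcases le_total 0 a with ha | ha
  · rw [flowStep_of_nonneg ha]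
    exact hu.forwardFlow hm ha
  · rw [flowStep_of_nonpos ha]
    exact hu.backwardFlow hm (neg_nonneg.2 ha)

lemma flowStep_le_add (hm : ∀ p x, -m ≤ H p x) (hu : CostDominated H c u)
    (hv : CostDominated H c v) (h : ∀ x, u x ≤ v x + D) (a : ℝ) (x : E) :
    flowStep H a u x ≤ flowStep H a v x + D := by
  rcases le_total 0 a with ha | ha
  · rw [flowStep_of_nonneg ha, flowStep_of_nonneg ha]
    exact hv.forwardFlow_le_forwardFlow_add hm ha h x
  · rw [flowStep_of_nonpos ha, flowStep_of_nonpos ha]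
    exact hu.backwardFlow_le_backwardFlow_add hm (neg_nonneg.2 ha) h x

lemma flowStep_mono (hm : ∀ p x, -m ≤ H p x) (hu : CostDominated H c u)
    (hv : CostDominated H c v) (h : u ≤ v) (a : ℝ) : flowStep H a u ≤ flowStep H a v := fun x => by
  simpa only [add_zero] using
    hu.flowStep_le_add hm hv (D := 0) (fun y => by simpa only [add_zero] using h y) a x

lemma abs_flowStep_sub_le (hm : ∀ p x, -m ≤ H p x) (hu : CostDominated H c u)
    (hv : CostDominated H c v) (h : ∀ x, |u x - v x| ≤ D) (a : ℝ) (x : E) :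
    |flowStep H a u x - flowStep H a v x| ≤ D := by
  rw [abs_sub_le_iff, sub_le_iff_le_add', sub_le_iff_le_add']
  exact ⟨hu.flowStep_le_add hm hv (fun x => by linarith [(abs_sub_le_iff.1 (h x)).1]) a x,
    hv.flowStep_le_add hm hu (fun x => by linarith [(abs_sub_le_iff.1 (h x)).2]) a x⟩

lemma flowStep_add (hm : ∀ p x, -m ≤ H p x) (hu : CostDominated H c u)
    (hab : 0 ≤ a ∧ 0 ≤ b ∨ a ≤ 0 ∧ b ≤ 0) :
    flowStep H (a + b) u = flowStep H a (flowStep H b u) := by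
  rcases hab with ⟨ha, hb⟩ | ⟨ha, hb⟩
  · rw [flowStep_of_nonneg ha, flowStep_of_nonneg hb, flowStep_of_nonneg (add_nonneg ha hb),
      hu.forwardFlow_add hm ha hb]
  · rw [flowStep_of_nonpos ha, flowStep_of_nonpos hb, flowStep_of_nonpos (add_nonpos ha hb),
      neg_add, hu.backwardFlow_add hm (neg_nonneg.2 ha) (neg_nonneg.2 hb)]

lemma flowStep_flowStep_le (hm : ∀ p x, -m ≤ H p x) (hu : CostDominated H c u) (ha : 0 ≤ a)
    (b : ℝ) : flowStep H a (flowStep H b u) ≤ flowStep H (a + b) u := by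
  rcases le_total 0 b with hb | hb
  · exact (hu.flowStep_add hm (.inl ⟨ha, hb⟩)).ge
  have hb' := neg_nonneg.2 hb
  rcases le_total 0 (a + b) with hab | hab
  · have hsplit := (hu.flowStep hm b).forwardFlow_add hm hab hb'
    rw [add_neg_cancel_right] at hsplit
    rw [flowStep_of_nonneg ha, hsplit, flowStep_of_nonneg hab, flowStep_of_nonpos hb]
    exact hu.forwardFlow_mono hm hab (hu.forwardFlow_backwardFlow_le hm hb')
  · have hsplit := hu.backwardFlow_add hm ha (neg_nonneg.2 hab)
    rw [neg_add, add_neg_cancel_left, ← neg_add] at hsplit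
    rw [flowStep_of_nonneg ha, flowStep_of_nonpos hb, hsplit, flowStep_of_nonpos hab]
    exact (hu.backwardFlow hm (neg_nonneg.2 hab)).forwardFlow_backwardFlow_le hm ha

lemma flowStep_add_le (hm : ∀ p x, -m ≤ H p x) (hu : CostDominated H c u) (hb : 0 ≤ b)
    (a : ℝ) : flowStep H (a + b) u ≤ flowStep H a (flowStep H b u) := by
  rcases le_total 0 a with ha | ha
  · exact (hu.flowStep_add hm (.inl ⟨ha, hb⟩)).le
  have hflip := hu.neg.flowStep_flowStep_le (neg_le_momentumFlip hm) (neg_nonneg.2 ha) (-b)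
  rwa [← neg_add, flowStep_momentumFlip, flowStep_momentumFlip, flowStep_momentumFlip,
    neg_le_neg_iff] at hflip

protected lemma discreteFlow (hm : ∀ p x, -m ≤ H p x) (hu : CostDominated H c u) (α : ℕ → ℝ)
    (n : ℕ) : CostDominated H c (discreteFlow H α n u) := by
  induction n with
  | zero => exact hu
  | succ n ih => exact ih.flowStep hm _

lemma discreteFlow_le_add (hm : ∀ p x, -m ≤ H p x) (hu : CostDominated H c u)
    (hv : CostDominated H c v) (h : ∀ x, u x ≤ v x + D) (α : ℕ → ℝ) (n : ℕ) (x : E) :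
    discreteFlow H α n u x ≤ discreteFlow H α n v x + D := by
  induction n generalizing x with
  | zero => exact h x
  | succ n ih => exact (hu.discreteFlow hm α n).flowStep_le_add hm (hv.discreteFlow hm α n) ih _ x

lemma discreteFlow_of_monotoneOn (hm : ∀ p x, -m ≤ H p x) (hu : CostDominated H c u)
    (hkn : k ≤ n) (hα : MonotoneOn α (Set.Icc k n) ∨ AntitoneOn α (Set.Icc k n)) :
    discreteFlow H α n u = flowStep H (α n - α k) (discreteFlow H α k u) := by
  induction n, hkn using Nat.le_induction with
  | base => rw [sub_self, flowStep_zero]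
  | succ n hkn ih =>
    have hsub : Set.Icc k n ⊆ Set.Icc k (n + 1) := Set.Icc_subset_Icc_right n.le_succ
    have hk : k ∈ Set.Icc k (n + 1) := ⟨le_rfl, hkn.trans n.le_succ⟩
    have hn : n ∈ Set.Icc k (n + 1) := ⟨hkn, n.le_succ⟩
    have hn' : n + 1 ∈ Set.Icc k (n + 1) := ⟨hkn.trans n.le_succ, le_rfl⟩
    rw [discreteFlow, ih (hα.imp (·.mono hsub) (·.mono hsub)),
      ← (hu.discreteFlow hm α k).flowStep_add hm, sub_add_sub_cancel]
    exact hα.imp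
      (fun h => ⟨sub_nonneg.2 (h hn hn' n.le_succ), sub_nonneg.2 (h hk hn hkn)⟩)
      (fun h => ⟨sub_nonpos.2 (h hn hn' n.le_succ), sub_nonpos.2 (h hk hn hkn)⟩)

lemma discreteFlow_comp_div (hm : ∀ p x, -m ≤ H p x) (hu : CostDominated H c u) (α : ℕ → ℝ)
    {j : ℕ} (hj : 0 < j) (n : ℕ) :
    discreteFlow H (fun k => α (k / j)) (n * j) u = discreteFlow H α n u := by
  induction n with
  | zero => rw [zero_mul, discreteFlow, discreteFlow]
  | succ n ih =>
    have hmem : Set.MapsTo (· / j) (Set.Icc (n * j) ((n + 1) * j)) (Set.Icc n (n + 1)) :=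
      fun k hk => ⟨(Nat.le_div_iff_mul_le hj).2 hk.1, Nat.div_le_of_le_mul (mul_comm j _ ▸ hk.2)⟩
    have hdiv : MonotoneOn (· / j) (Set.Icc (n * j) ((n + 1) * j)) :=
      fun _ _ _ _ h => Nat.div_le_div_right h
    have hblock : MonotoneOn α (Set.Icc n (n + 1)) ∨ AntitoneOn α (Set.Icc n (n + 1)) := by
      simp only [MonotoneOn, AntitoneOn, Set.mem_Icc]
      grind [le_total (α n) (α (n + 1))]
    have hstep := hu.discreteFlow_of_monotoneOn hm (Nat.mul_le_mul_right j n.le_succ)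
      (hblock.imp (·.comp hdiv hmem) (·.comp_MonotoneOn hdiv hmem))
    simp only [Function.comp_def, Nat.mul_div_cancel _ hj] at hstep
    rw [hstep, ih, discreteFlow]

lemma flowStep_discreteFlow_le (hm : ∀ p x, -m ≤ H p x) (hu : CostDominated H c u)
    (h0 : α 0 = β 0) (hM : ∀ i ≤ n, α i - β i ≤ M) :
    flowStep H (M - (α n - β n)) (discreteFlow H α n u) ≤
      discreteFlow H β n (flowStep H M u) := by
  induction n with
  | zero => rw [h0, sub_self, sub_zero, discreteFlow, discreteFlow]
  | succ n ih =>
    have hgap : 0 ≤ M - (α n - β n) := by linarith [hM n n.le_succ]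
    have hgap' : 0 ≤ M - (α (n + 1) - β (n + 1)) := by linarith [hM (n + 1) le_rfl]
    have hα := hu.discreteFlow hm α n
    calc flowStep H (M - (α (n + 1) - β (n + 1)))
          (flowStep H (α (n + 1) - α n) (discreteFlow H α n u))
        ≤ flowStep H (M - (α (n + 1) - β (n + 1)) + (α (n + 1) - α n)) (discreteFlow H α n u) :=
          hα.flowStep_flowStep_le hm hgap' _
      _ = flowStep H (β (n + 1) - β n + (M - (α n - β n))) (discreteFlow H α n u) := by
          congr 1
          ring
      _ ≤ flowStep H (β (n + 1) - β n) (flowStep H (M - (α n - β n)) (discreteFlow H α n u)) :=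
          hα.flowStep_add_le hm hgap _
      _ ≤ flowStep H (β (n + 1) - β n) (discreteFlow H β n (flowStep H M u)) :=
          (hα.flowStep hm _).flowStep_mono hm ((hu.flowStep hm M).discreteFlow hm β n)
            (ih fun i hi => hM i (hi.trans n.le_succ)) _

lemma discreteFlow_le (hm : ∀ p x, -m ≤ H p x) (hu : CostDominated H c u) (h0 : α 0 = β 0)
    (hM : ∀ i ≤ n, α i - β i ≤ M) (x : E) :
    discreteFlow H α n u x ≤
      discreteFlow H β n u x + c * M + m * (M - (α n - β n)) := by
  have hM0 : 0 ≤ M := by linarith [hM 0 n.zero_le]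
  have hgap : 0 ≤ M - (α n - β n) := by linarith [hM n le_rfl]
  have hlift := (hu.discreteFlow hm α n).le_forwardFlow_add hm hgap x
  have hcomp := hu.flowStep_discreteFlow_le hm h0 hM x
  have hdrop := (hu.flowStep hm M).discreteFlow_le_add hm hu
    (fun y => by simpa only [flowStep_of_nonneg hM0] using hu.forwardFlow_le_add hm hM0 y) β n x
  rw [flowStep_of_nonneg hgap] at hcomp
  linarith

lemma abs_discreteFlow_sub_le (hm0 : 0 ≤ m) (hm : ∀ p x, -m ≤ H p x) (hu : CostDominated H c u)
    (h0 : α 0 = β 0) (hM : ∀ i ≤ n, |α i - β i| ≤ M) (x : E) :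
    |discreteFlow H α n u x - discreteFlow H β n u x| ≤ (c + 2 * m) * M := by
  have hle := hu.discreteFlow_le hm h0 (fun i hi => (abs_sub_le_iff.1 (hM i hi)).1) x
  have hge := hu.discreteFlow_le hm h0.symm (fun i hi => (abs_sub_le_iff.1 (hM i hi)).2) x
  obtain ⟨hαβ, hβα⟩ := abs_sub_le_iff.1 (hM n le_rfl)
  have hmα := mul_le_mul_of_nonneg_left hαβ hm0
  have hmβ := mul_le_mul_of_nonneg_left hβα hm0
  rw [abs_sub_le_iff]
  constructor <;> linarith

end CostDominated

end DiscreteFlow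

section DyadicGrid

variable {ζ : C(ℝ≥0, ℝ)} {n k : ℕ} {s t : ℝ≥0}

/-- The values of `ζ`, stopped at time `t`, on the grid of mesh `2⁻ⁿ`. -/
noncomputable def sample (ζ : C(ℝ≥0, ℝ)) (n : ℕ) (t : ℝ≥0) (k : ℕ) : ℝ :=
  ζ (min ((k : ℝ≥0) / 2 ^ n) t)

lemma sample_zero (ζ : C(ℝ≥0, ℝ)) (n : ℕ) (t : ℝ≥0) : sample ζ n t 0 = ζ 0 := by
  simp only [sample, Nat.cast_zero, zero_div, min_eq_left zero_le]

lemma sample_of_le (ζ : C(ℝ≥0, ℝ)) (h : t * 2 ^ n ≤ k) : sample ζ n t k = ζ t := by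
  rw [sample, min_eq_right ((le_div_iff₀ (by positivity)).2 h)]

lemma mul_le_ceil_mul (t : ℝ≥0) (n : ℕ) : t * 2 ^ n ≤ ((⌈t⌉₊ * 2 ^ n : ℕ) : ℝ≥0) := by
  push_cast
  gcongr
  exact Nat.le_ceil t

lemma dist_min_le (a b t : ℝ≥0) : dist (min a t) (min b t) ≤ dist a b := by
  rw [NNReal.dist_eq, NNReal.dist_eq, NNReal.coe_min, NNReal.coe_min]
  exact abs_inf_sub_inf_le_abs _ _ _

lemma dist_div_two_pow_le (i j n : ℕ) :
    dist (((i / 2 ^ j : ℕ) : ℝ≥0) / 2 ^ n) ((i : ℝ≥0) / 2 ^ (n + j)) ≤ (1 / 2) ^ n := by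
  have hfloor : ((i / 2 ^ j : ℕ) : ℝ) = ⌊(i : ℝ) / 2 ^ j⌋₊ := by
    exact_mod_cast (Nat.floor_div_eq_div (K := ℝ) i (2 ^ j)).symm
  have hle := Nat.floor_le (show 0 ≤ (i : ℝ) / 2 ^ j by positivity)
  have hlt := Nat.sub_one_lt_floor ((i : ℝ) / 2 ^ j)
  have hsplit : (i : ℝ) / 2 ^ (n + j) = (i : ℝ) / 2 ^ j / 2 ^ n := by
    rw [pow_add, div_div, mul_comm]
  rw [NNReal.dist_eq]
  push_cast
  rw [hfloor, hsplit, ← sub_div, abs_div, abs_of_pos (by positivity : (0 : ℝ) < 2 ^ n),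
    one_div_pow]
  gcongr
  rw [abs_le]
  constructor <;> linarith

/-- `HasModulus ζ t n ω`: on `[0, t]`, the path `ζ` oscillates by at most `ω` over time intervals of
length `2⁻ⁿ`. -/
def HasModulus (ζ : C(ℝ≥0, ℝ)) (t : ℝ≥0) (n : ℕ) (ω : ℝ) : Prop :=
  ∀ r ≤ t, ∀ s ≤ t, dist r s ≤ (1 / 2) ^ n → |ζ r - ζ s| ≤ ω

lemma HasModulus.mono {ω : ℝ} (h : HasModulus ζ t n ω) (hst : s ≤ t) : HasModulus ζ s n ω :=
  fun r hr r' hr' => h r (hr.trans hst) r' (hr'.trans hst)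

lemma exists_hasModulus (ζ : C(ℝ≥0, ℝ)) (t : ℝ≥0) {ω : ℝ} (hω : 0 < ω) :
    ∃ n, HasModulus ζ t n ω := by
  have huc := (isCompact_Icc (a := (0 : ℝ≥0)) (b := t)).uniformContinuousOn_of_continuous
    ζ.continuous.continuousOn
  obtain ⟨δ, hδ, h⟩ := Metric.uniformContinuousOn_iff.1 huc ω hω
  obtain ⟨n, hn⟩ := exists_pow_lt_of_lt_one hδ (by norm_num : (1 / 2 : ℝ) < 1)
  exact ⟨n, fun r hr s hs hrs => (h r ⟨zero_le, hr⟩ s ⟨zero_le, hs⟩ (hrs.trans_lt hn)).le⟩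

/-- The dyadic grid stopped at `s`, followed from its first point beyond `s` on by the grid stopped
at `t`. Unlike the grid stopped at `t` itself, it passes through `s`. -/
noncomputable def spliceTime (n : ℕ) (s t : ℝ≥0) (k : ℕ) : ℝ≥0 :=
  if k ≤ ⌈s * 2 ^ n⌉₊ then min (k / 2 ^ n) s else min (k / 2 ^ n) t

lemma monotone_spliceTime (n : ℕ) (hst : s ≤ t) : Monotone (spliceTime n s t) := by
  intro k l hkl
  have hdiv : (k : ℝ≥0) / 2 ^ n ≤ l / 2 ^ n := by gcongr
  by_cases hl : l ≤ ⌈s * 2 ^ n⌉₊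
  · rw [spliceTime, spliceTime, if_pos (hkl.trans hl), if_pos hl]
    exact min_le_min_right _ hdiv
  rw [spliceTime, spliceTime, if_neg hl]
  split_ifs
  · exact min_le_min hdiv hst
  · exact min_le_min_right _ hdiv

lemma spliceTime_ceil (n : ℕ) (s t : ℝ≥0) : spliceTime n s t ⌈s * 2 ^ n⌉₊ = s := by
  rw [spliceTime, if_pos le_rfl, min_eq_right ((le_div_iff₀ (by positivity)).2 (Nat.le_ceil _))]

lemma spliceTime_of_le (hs : ⌈s * 2 ^ n⌉₊ < k) (ht : t * 2 ^ n ≤ k) :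
    spliceTime n s t k = t := by
  rw [spliceTime, if_neg hs.not_ge, min_eq_right ((le_div_iff₀ (by positivity)).2 ht)]

lemma spliceTime_le (hst : s ≤ t) (k : ℕ) : spliceTime n s t k ≤ t := by
  rw [spliceTime]
  split_ifs
  · exact (min_le_right _ _).trans hst
  · exact min_le_right _ _

lemma dist_spliceTime_le (n : ℕ) (hst : s ≤ t) (k : ℕ) :
    dist (min ((k : ℝ≥0) / 2 ^ n) t) (spliceTime n s t k) ≤ (1 / 2) ^ n := by
  rw [spliceTime]
  split_ifs with hk
  · rcases le_total ((k : ℝ≥0) / 2 ^ n) s with hks | hks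
    · rw [min_eq_left hks, min_eq_left (hks.trans hst), dist_self]
      positivity
    · have hle : (k : ℝ≥0) / 2 ^ n ≤ s + (1 / 2) ^ n := by
        rw [div_le_iff₀ (by positivity), add_mul, ← mul_pow, one_div,
          inv_mul_cancel₀ two_ne_zero, one_pow]
        exact (Nat.cast_le.2 hk).trans (Nat.ceil_lt_add_one zero_le).le
      rw [min_eq_right hks, NNReal.dist_eq,
        abs_of_nonneg (sub_nonneg.2 (NNReal.coe_le_coe.2 (le_min hks hst))), sub_le_iff_le_add']
      exact_mod_cast (min_le_left _ _).trans hle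
  · rw [dist_self]
    positivity

end DyadicGrid

section PathFlow

variable {E : Type*} [NormedAddCommGroup E] [InnerProductSpace ℝ E]

/-- The flow along the samples of `ζ` up to time `t`. -/
noncomputable def gridFlow (H : E → E → ℝ) (ζ : C(ℝ≥0, ℝ)) (u : E → ℝ) (n : ℕ) (t : ℝ≥0) :
    E → ℝ :=
  discreteFlow H (sample ζ n t) (⌈t⌉₊ * 2 ^ n) u

/-- The flow along a continuous path, the limit of the flows along its dyadic samples. -/
noncomputable def pathFlow (H : E → E → ℝ) (ζ : C(ℝ≥0, ℝ)) (u : E → ℝ) (t : ℝ≥0) (x : E) : ℝ :=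
  limUnder atTop fun n => gridFlow H ζ u n t x

variable {H : E → E → ℝ} {m c D M ω : ℝ} {u v : E → ℝ} {ζ : C(ℝ≥0, ℝ)} {n k : ℕ} {s t : ℝ≥0}

lemma discreteFlow_sample (ζ : C(ℝ≥0, ℝ)) (hk : t * 2 ^ n ≤ k) (u : E → ℝ) :
    discreteFlow H (sample ζ n t) k u = gridFlow H ζ u n t := by
  have hconst : ∀ {i j : ℕ}, t * 2 ^ n ≤ i → i ≤ j →
      discreteFlow H (sample ζ n t) j u = discreteFlow H (sample ζ n t) i u := fun hi hij =>
    discreteFlow_of_const_tail hij (fun l hl => by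
      rw [sample_of_le ζ hi, sample_of_le ζ (hi.trans (Nat.cast_le.2 hl))]) u
  rcases le_total k (⌈t⌉₊ * 2 ^ n) with h | h
  · exact (hconst hk h).symm
  · exact hconst (mul_le_ceil_mul t n) h

namespace CostDominated

protected lemma gridFlow (hm : ∀ p x, -m ≤ H p x) (hu : CostDominated H c u) (ζ : C(ℝ≥0, ℝ))
    (n : ℕ) (t : ℝ≥0) : CostDominated H c (gridFlow H ζ u n t) :=
  hu.discreteFlow hm _ _

lemma abs_gridFlow_sub_le (hm0 : 0 ≤ m) (hm : ∀ p x, -m ≤ H p x) (hu : CostDominated H c u)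
    (hnk : n ≤ k) (hω : HasModulus ζ t n ω) (x : E) :
    |gridFlow H ζ u n t x - gridFlow H ζ u k t x| ≤ (c + 2 * m) * ω := by
  obtain ⟨j, rfl⟩ := Nat.exists_eq_add_of_le hnk
  have hrefine : gridFlow H ζ u n t =
      discreteFlow H (fun i => sample ζ n t (i / 2 ^ j)) (⌈t⌉₊ * 2 ^ (n + j)) u := by
    rw [pow_add, ← mul_assoc, hu.discreteFlow_comp_div hm _ (by positivity), gridFlow]
  rw [hrefine, gridFlow]
  refine hu.abs_discreteFlow_sub_le hm0 hm ?_
    (fun i _ => hω _ (min_le_right _ _) _ (min_le_right _ _) ?_) x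
  · change sample ζ n t (0 / 2 ^ j) = sample ζ (n + j) t 0
    rw [Nat.zero_div, sample_zero, sample_zero]
  · exact (dist_min_le _ _ _).trans (dist_div_two_pow_le i j n)

lemma tendsto_gridFlow (hm0 : 0 ≤ m) (hm : ∀ p x, -m ≤ H p x) (hu : CostDominated H c u)
    (ζ : C(ℝ≥0, ℝ)) (t : ℝ≥0) (x : E) :
    Tendsto (fun n => gridFlow H ζ u n t x) atTop (𝓝 (pathFlow H ζ u t x)) := by
  have hcauchy : CauchySeq fun n => gridFlow H ζ u n t x := by
    refine Metric.cauchySeq_iff'.2 fun ε hε => ?_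
    obtain ⟨ω, hω0, hω⟩ := exists_pos_mul_lt hε (c + 2 * m)
    obtain ⟨n, hn⟩ := exists_hasModulus ζ t hω0
    refine ⟨n, fun k hk => ?_⟩
    rw [dist_comm, Real.dist_eq]
    exact (hu.abs_gridFlow_sub_le hm0 hm hk hn x).trans_lt hω
  exact hcauchy.tendsto_limUnder

lemma abs_gridFlow_sub_pathFlow_le (hm0 : 0 ≤ m) (hm : ∀ p x, -m ≤ H p x)
    (hu : CostDominated H c u) (hω : HasModulus ζ t n ω) (x : E) :
    |gridFlow H ζ u n t x - pathFlow H ζ u t x| ≤ (c + 2 * m) * ω := by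
  refine le_of_tendsto ((hu.tendsto_gridFlow hm0 hm ζ t x).const_sub _).abs ?_
  filter_upwards [eventually_ge_atTop n] with k hk
  exact hu.abs_gridFlow_sub_le hm0 hm hk hω x

protected lemma pathFlow (hm0 : 0 ≤ m) (hm : ∀ p x, -m ≤ H p x) (hu : CostDominated H c u)
    (ζ : C(ℝ≥0, ℝ)) (t : ℝ≥0) : CostDominated H c (pathFlow H ζ u t) := fun _ x y _ h =>
  le_of_tendsto' ((hu.tendsto_gridFlow hm0 hm ζ t y).sub (hu.tendsto_gridFlow hm0 hm ζ t x))
    fun n => hu.gridFlow hm ζ n t h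

lemma pathFlow_le_add (hm0 : 0 ≤ m) (hm : ∀ p x, -m ≤ H p x) (hu : CostDominated H c u)
    (hv : CostDominated H c v) (h : ∀ x, u x ≤ v x + D) (ζ : C(ℝ≥0, ℝ)) (t : ℝ≥0) (x : E) :
    pathFlow H ζ u t x ≤ pathFlow H ζ v t x + D :=
  le_of_tendsto_of_tendsto' (hu.tendsto_gridFlow hm0 hm ζ t x)
    ((hv.tendsto_gridFlow hm0 hm ζ t x).add_const D)
    fun n => hu.discreteFlow_le_add hm hv h (sample ζ n t) _ x

lemma pathFlow_le (hm0 : 0 ≤ m) (hm : ∀ p x, -m ≤ H p x) (hu : CostDominated H c u)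
    {ζ₁ ζ₂ : C(ℝ≥0, ℝ)} (h0 : ζ₁ 0 = ζ₂ 0) (hM : ∀ s ≤ t, ζ₁ s - ζ₂ s ≤ M) (x : E) :
    pathFlow H ζ₁ u t x ≤ pathFlow H ζ₂ u t x + c * M + m * (M - (ζ₁ t - ζ₂ t)) := by
  refine le_of_tendsto_of_tendsto' (hu.tendsto_gridFlow hm0 hm ζ₁ t x)
    (((hu.tendsto_gridFlow hm0 hm ζ₂ t x).add_const (c * M)).add_const _) fun n => ?_
  have hgrid := hu.discreteFlow_le hm (α := sample ζ₁ n t) (β := sample ζ₂ n t)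
    (n := ⌈t⌉₊ * 2 ^ n) (by rw [sample_zero, sample_zero, h0])
    (fun i _ => hM _ (min_le_right _ _)) x
  rwa [sample_of_le ζ₁ (mul_le_ceil_mul t n), sample_of_le ζ₂ (mul_le_ceil_mul t n)] at hgrid

lemma abs_pathFlow_sub_le (hm0 : 0 ≤ m) (hm : ∀ p x, -m ≤ H p x) (hu : CostDominated H c u)
    (hst : s ≤ t) (hM : ∀ r, s ≤ r → r ≤ t → |ζ r - ζ s| ≤ M) (x : E) :
    |pathFlow H ζ u t x - pathFlow H ζ u s x| ≤ (c + 2 * m) * M := by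
  refine le_of_tendsto' ((hu.tendsto_gridFlow hm0 hm ζ t x).sub
    (hu.tendsto_gridFlow hm0 hm ζ s x)).abs fun n => ?_
  have hN : s * 2 ^ n ≤ ((⌈t⌉₊ * 2 ^ n : ℕ) : ℝ≥0) :=
    (mul_le_mul_left hst _).trans (mul_le_ceil_mul t n)
  rw [← discreteFlow_sample ζ hN, gridFlow]
  refine hu.abs_discreteFlow_sub_le hm0 hm (by rw [sample_zero, sample_zero]) (fun i _ => ?_) x
  simp only [sample]
  rcases le_total ((i : ℝ≥0) / 2 ^ n) s with h | h
  · rw [min_eq_left h, min_eq_left (h.trans hst), sub_self, abs_zero]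
    exact (abs_nonneg _).trans (hM s le_rfl hst)
  · rw [min_eq_right h]
    exact hM _ (le_min h hst) (min_le_right _ _)

lemma discreteFlow_comp_spliceTime (hm : ∀ p x, -m ≤ H p x) (hu : CostDominated H c u)
    (hst : s ≤ t) (hζ : MonotoneOn ζ (Set.Icc s t) ∨ AntitoneOn ζ (Set.Icc s t))
    (hs : ⌈s * 2 ^ n⌉₊ < k) (ht : t * 2 ^ n ≤ k) :
    discreteFlow H (ζ ∘ spliceTime n s t) k u = flowStep H (ζ t - ζ s) (gridFlow H ζ u n s) := by
  have hmono := monotone_spliceTime n hst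
  have hmem : Set.MapsTo (spliceTime n s t) (Set.Icc ⌈s * 2 ^ n⌉₊ k) (Set.Icc s t) := fun i hi =>
    ⟨(spliceTime_ceil n s t).symm.trans_le (hmono hi.1), spliceTime_le hst i⟩
  rw [hu.discreteFlow_of_monotoneOn hm hs.le
    (hζ.imp (·.comp (hmono.monotoneOn _) hmem) (·.comp_MonotoneOn (hmono.monotoneOn _) hmem)),
    Function.comp_apply, Function.comp_apply, spliceTime_ceil, spliceTime_of_le hs ht,
    ← discreteFlow_sample ζ (Nat.le_ceil _),
    discreteFlow_congr (β := sample ζ n s) fun i hi => by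
      rw [Function.comp_apply, spliceTime, if_pos hi, sample]]

lemma abs_gridFlow_sub_flowStep_le (hm0 : 0 ≤ m) (hm : ∀ p x, -m ≤ H p x)
    (hu : CostDominated H c u) (hst : s ≤ t)
    (hζ : MonotoneOn ζ (Set.Icc s t) ∨ AntitoneOn ζ (Set.Icc s t)) (hω : HasModulus ζ t n ω)
    (x : E) :
    |gridFlow H ζ u n t x - flowStep H (ζ t - ζ s) (gridFlow H ζ u n s) x| ≤ (c + 2 * m) * ω := by
  have ht : t * 2 ^ n ≤ ((⌈t⌉₊ * 2 ^ n + 1 : ℕ) : ℝ≥0) :=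
    (mul_le_ceil_mul t n).trans (Nat.cast_le.2 (Nat.le_succ _))
  have hs : ⌈s * 2 ^ n⌉₊ < ⌈t⌉₊ * 2 ^ n + 1 :=
    Nat.lt_succ_of_le (Nat.ceil_le.2 ((mul_le_mul_left hst _).trans (mul_le_ceil_mul t n)))
  rw [← discreteFlow_sample ζ ht, ← hu.discreteFlow_comp_spliceTime hm hst hζ hs ht]
  refine hu.abs_discreteFlow_sub_le hm0 hm ?_ (fun i _ => ?_) x
  · simp only [sample_zero, Function.comp_apply, spliceTime, Nat.cast_zero, zero_div, zero_le,
      if_true, min_eq_left]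
  · exact hω _ (min_le_right _ _) _ (spliceTime_le hst i) (dist_spliceTime_le n hst i)

lemma pathFlow_of_monotoneOn (hm0 : 0 ≤ m) (hm : ∀ p x, -m ≤ H p x) (hu : CostDominated H c u)
    (hst : s ≤ t) (hζ : MonotoneOn ζ (Set.Icc s t) ∨ AntitoneOn ζ (Set.Icc s t)) :
    pathFlow H ζ u t = flowStep H (ζ t - ζ s) (pathFlow H ζ u s) := by
  funext x
  refine eq_of_abs_sub_le_all fun ε hε => ?_
  obtain ⟨ω, hω0, hω⟩ := exists_pos_mul_lt hε (3 * (c + 2 * m))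
  obtain ⟨n, hn⟩ := exists_hasModulus ζ t hω0
  have ht := abs_le.1 (hu.abs_gridFlow_sub_pathFlow_le hm0 hm hn x)
  have hgrid := abs_le.1 (hu.abs_gridFlow_sub_flowStep_le hm0 hm hst hζ hn x)
  have hs := abs_le.1 ((hu.gridFlow hm ζ n s).abs_flowStep_sub_le hm (hu.pathFlow hm0 hm ζ s)
    (hu.abs_gridFlow_sub_pathFlow_le hm0 hm (hn.mono hst)) (ζ t - ζ s) x)
  rw [abs_le]
  constructor <;> linarith

end CostDominated

lemma pathFlow_zero (ζ : C(ℝ≥0, ℝ)) (u : E → ℝ) : pathFlow H ζ u 0 = u := by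
  funext x
  simp only [pathFlow, gridFlow, Nat.ceil_zero, zero_mul, discreteFlow]
  exact tendsto_const_nhds.limUnder_eq

lemma pathFlow_momentumFlip (hm0 : 0 ≤ m) (hm : ∀ p x, -m ≤ H p x) (hu : CostDominated H c u)
    (ζ : C(ℝ≥0, ℝ)) (t : ℝ≥0) :
    pathFlow (momentumFlip H) (-ζ) (-u) t = -pathFlow H ζ u t := by
  funext x
  refine tendsto_nhds_unique (hu.neg.tendsto_gridFlow hm0 (neg_le_momentumFlip hm) (-ζ) t x) ?_
  refine (hu.tendsto_gridFlow hm0 hm ζ t x).neg.congr fun n => ?_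
  exact (congrFun (discreteFlow_momentumFlip (sample ζ n t) _ u) x).symm

end PathFlow

section ConvexFunctions

lemma exists_pos_support_line {ν : ℝ → ℝ} (hc : ConvexOn ℝ (Set.Ici 0) ν)
    (hm : StrictMonoOn ν (Set.Ici 0)) {K : ℝ} (hK : 0 < K) :
    ∃ σ > 0, ∀ r, 0 ≤ r → ν K + σ * (r - K) ≤ ν r := by
  have hKi : K ∈ interior (Set.Ici (0 : ℝ)) := by rwa [interior_Ici]
  have hleft : ∀ r, 0 ≤ r → r < K → slope ν r K ≤ derivWithin ν (Set.Iio K) K :=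
    fun r hr h => hc.slope_le_leftDeriv_of_mem_interior hr hKi h
  refine ⟨derivWithin ν (Set.Iio K) K, ?_, fun r hr => ?_⟩
  · refine lt_of_lt_of_le ?_ (hleft 0 le_rfl hK)
    rw [slope_def_field]
    exact div_pos (sub_pos.2 (hm Set.self_mem_Ici hK.le hK)) (sub_pos.2 hK)
  · rcases lt_trichotomy r K with h | rfl | h
    · have hslope := hleft r hr h
      rw [slope_def_field, div_le_iff₀ (by linarith)] at hslope
      linarith
    · simp only [sub_self, mul_zero, add_zero, le_refl]
    · have hslope := (hc.leftDeriv_le_rightDeriv_of_mem_interior hKi).trans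
        (hc.rightDeriv_le_slope_of_mem_interior hKi (y := r) hr h)
      rw [slope_def_field, le_div_iff₀ (by linarith)] at hslope
      linarith

lemma continuousOn_Ici_of_convexOn_of_monotoneOn {ν : ℝ → ℝ} (hc : ConvexOn ℝ (Set.Ici 0) ν)
    (hm : MonotoneOn ν (Set.Ici 0)) : ContinuousOn ν (Set.Ici 0) := by
  refine hc.continuousOn_Ici ?_
  have hchord : Tendsto (fun r : ℝ => ν 0 + r * (ν 1 - ν 0)) (𝓝[≥] 0) (𝓝 (ν 0)) := by
    have hcont : Continuous fun r : ℝ => ν 0 + r * (ν 1 - ν 0) := by fun_prop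
    simpa only [zero_mul, add_zero] using (hcont.tendsto 0).mono_left nhdsWithin_le_nhds
  refine tendsto_of_tendsto_of_tendsto_of_le_of_le' tendsto_const_nhds hchord ?_ ?_
  · filter_upwards [self_mem_nhdsWithin] with s hs
    exact hm Set.self_mem_Ici hs hs
  · filter_upwards [self_mem_nhdsWithin, nhdsWithin_le_nhds (Iic_mem_nhds one_pos)] with s hs hs1
    have h := hc.2 (x := 0) (y := 1) Set.self_mem_Ici (Set.mem_Ici.2 zero_le_one)
      (sub_nonneg.2 hs1) hs (sub_add_cancel _ _)
    simp only [smul_eq_mul, mul_zero, mul_one, zero_add] at h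
    linarith

variable {E : Type*} [NormedAddCommGroup E]

lemma exists_affine_add_gap_le [InnerProductSpace ℝ E] [CompleteSpace E] {f : E → ℝ}
    (hf : ConvexOn ℝ Set.univ f) (hfc : Continuous f) {σ C : ℝ} (hσ : 0 < σ)
    (hfσ : ∀ p, σ * ‖p‖ - C ≤ f p) (p₀ : E) {ε : ℝ} (hε : 0 < ε) :
    ∃ (q : E) (b : ℝ), ∃ δ > 0, f p₀ - ε ≤ inner ℝ q p₀ - b ∧
      ∀ p, inner ℝ q p - b + δ * (1 + ‖p‖) ≤ f p := by
  set a : ℝ := f p₀ - ε / 2 with ha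
  obtain ⟨l, c, hl, hlp₀⟩ := ConvexOn.exists_affine_le_of_lt (𝕜 := ℝ) (s := Set.univ)
    (φ := f) (x := p₀) (a := a) (Set.mem_univ _) (by linarith)
    isClosed_univ (hfc.lowerSemicontinuous.lowerSemicontinuousOn _) hf
  obtain ⟨q, rfl⟩ := (InnerProductSpace.toDual ℝ E).surjective l
  have hq : ∀ p, inner ℝ q p + c ≤ f p := fun p => by simpa using hl ⟨p, Set.mem_univ p⟩
  have hqp₀ : inner ℝ q p₀ + c = a := by simpa using hlp₀
  obtain ⟨θ, hθε, hθ0, hθ1⟩ : ∃ θ : ℝ, θ * (a + C + σ) < ε / 2 ∧ 0 < θ ∧ θ < 1 := by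
    have hlim : Tendsto (fun θ : ℝ => θ * (a + C + σ)) (𝓝[>] 0) (𝓝 0) := by
      have h := (continuous_mul_const (a + C + σ)).tendsto 0
      rw [zero_mul] at h
      exact h.mono_left nhdsWithin_le_nhds
    exact ((hlim.eventually_lt_const (half_pos hε)).and (Ioo_mem_nhdsGT one_pos)).exists
  refine ⟨(1 - θ) • q, θ * C + θ * σ - (1 - θ) * c, θ * σ, mul_pos hθ0 hσ, ?_, fun p => ?_⟩
  · rw [real_inner_smul_left]
    linear_combination hθε.le - (1 - θ) * hqp₀ - ha
  · have hmix := add_le_add (mul_le_mul_of_nonneg_left (hq p) (sub_nonneg.2 hθ1.le))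
      (mul_le_mul_of_nonneg_left (hfσ p) hθ0.le)
    rw [real_inner_smul_left]
    linarith

lemma eventually_forall_nonneg_of_convexOn [NormedSpace ℝ E] [ProperSpace E] {X : Type*}
    [TopologicalSpace X] {G : E → X → ℝ} (hG : Continuous fun w : X × E => G w.2 w.1)
    (hconv : ∀ x, ConvexOn ℝ Set.univ fun p => G p x) {x₀ : X} {δ : ℝ} (hδ : 0 < δ)
    (hgap : ∀ p, δ * (1 + ‖p‖) ≤ G p x₀) : ∀ᶠ z in 𝓝 x₀, ∀ p, 0 ≤ G p z := by
  have hG0 : 0 < G 0 x₀ := hδ.trans_le (by simpa using hgap 0)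
  set R : ℝ := G 0 x₀ / δ with hR
  have hRpos : 0 < R := div_pos hG0 hδ
  have hball : ∀ᶠ z in 𝓝 x₀, ∀ p ∈ Metric.closedBall (0 : E) R, 0 < G p z :=
    (isCompact_closedBall _ _).eventually_forall_of_forall_eventually fun p _ =>
      (hG.tendsto (x₀, p)).eventually_const_lt
        ((mul_pos hδ (by positivity)).trans_le (hgap p))
  have hsphere : ∀ᶠ z in 𝓝 x₀, ∀ p ∈ Metric.sphere (0 : E) R, G 0 z < G p z := by
    refine (isCompact_sphere _ _).eventually_forall_of_forall_eventually fun p hp => ?_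
    have hG0c : Continuous fun w : X × E => G 0 w.1 :=
      hG.comp (continuous_fst.prodMk continuous_const)
    refine (hG0c.tendsto (x₀, p)).eventually_lt (hG.tendsto (x₀, p)) ?_
    have hδR : δ * R = G 0 x₀ := by rw [hR, mul_div_cancel₀ _ hδ.ne']
    have hp_gap := hgap p
    rw [mem_sphere_zero_iff_norm.1 hp] at hp_gap
    linarith
  filter_upwards [hball, hsphere] with z hzb hzs p
  rcases le_or_gt ‖p‖ R with hp | hp
  · exact (hzb p (mem_closedBall_zero_iff.2 hp)).le
  have hp0 : 0 < ‖p‖ := hRpos.trans hp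
  have hpR : ‖(R / ‖p‖) • p‖ = R := by
    rw [norm_smul, Real.norm_of_nonneg (by positivity), div_mul_cancel₀ _ hp0.ne']
  have hz := hzs _ (mem_sphere_zero_iff_norm.2 hpR)
  have hle : G ((R / ‖p‖) • p) z ≤ G p z := by
    simpa only [smul_zero, zero_add] using (hconv z).le_right_of_left_le' (x := 0)
      (Set.mem_univ 0) (Set.mem_univ p) (sub_nonneg.2 ((div_le_one hp0).2 hp.le))
      (div_pos hRpos hp0) (sub_add_cancel _ _) (by simpa only [smul_zero, zero_add] using hz.le)
  exact ((hzb 0 (Metric.mem_closedBall_self hRpos.le)).trans hz).le.trans hle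

end ConvexFunctions

section SmoothFunctions

variable {E : Type*} [NormedAddCommGroup E] [InnerProductSpace ℝ E] [CompleteSpace E]
  {H : E → E → ℝ}

lemma Admissible.sub_le {f : E → ℝ} (hf : Differentiable ℝ f) {y q : E} {b h s : ℝ} (hs : 0 ≤ s)
    (ha : Admissible H q b y (y + s • q))
    (hh : ∀ z ∈ segment ℝ y (y + s • q), H (gradient f z) z ≤ h) :
    f (y + s • q) - f y ≤ s * b + h * s := by
  obtain ⟨z, hz, hmvt⟩ := domain_mvt
    (fun z _ => (hf z).hasGradientAt.hasFDerivAt.hasFDerivWithinAt)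
    (convex_segment y (y + s • q)) (left_mem_segment ..) (right_mem_segment ..)
  rw [add_sub_cancel_left, map_smul, InnerProductSpace.toDual_apply_apply, smul_eq_mul,
    real_inner_comm] at hmvt
  rw [hmvt]
  linarith [mul_le_mul_of_nonneg_left ((ha z hz (gradient f z)).trans (hh z hz)) hs]

end SmoothFunctions

namespace IsConvexCoerciveHamiltonian

variable {d : ℕ} {H : Space d → Space d → ℝ} {νl νu : ℝ → ℝ}

protected lemma momentumFlip (hH : IsConvexCoerciveHamiltonian H νl νu) :
    IsConvexCoerciveHamiltonian (momentumFlip H) νl νu where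
  continuous_uncurry :=
    hH.continuous_uncurry.comp ((continuous_neg.comp continuous_fst).prodMk continuous_snd)
  convex x := by
    simpa [momentumFlip, Function.comp_def] using
      (hH.convex x).comp_linearMap (-LinearMap.id : Space d →ₗ[ℝ] Space d)
  lower_convex := hH.lower_convex
  lower_strictMono := hH.lower_strictMono
  upper_convex := hH.upper_convex
  upper_mono := hH.upper_mono
  lower_le p x := by simpa only [momentumFlip, norm_neg] using hH.lower_le (-p) x
  le_upper p x := by simpa only [momentumFlip, norm_neg] using hH.le_upper (-p) x

lemma neg_negPart_le (hH : IsConvexCoerciveHamiltonian H νl νu) (p x : Space d) :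
    -(νl 0)⁻ ≤ H p x :=
  calc -(νl 0)⁻ ≤ νl 0 := neg_le.1 (neg_le_negPart (νl 0))
    _ ≤ νl ‖p‖ :=
      hH.lower_strictMono.monotoneOn Set.self_mem_Ici (norm_nonneg p) (norm_nonneg p)
    _ ≤ H p x := hH.lower_le p x

lemma mul_norm_le (hH : IsConvexCoerciveHamiltonian H νl νu) {q z y : Space d} {b R : ℝ}
    (hR : 0 ≤ R) (ha : Admissible H q b z y) : R * ‖q‖ ≤ b + νu R := by
  set p : Space d := (R / ‖q‖) • q with hp
  have hpR : ‖p‖ ≤ R := by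
    rw [hp, norm_smul, Real.norm_of_nonneg (by positivity)]
    exact (div_mul_comm ..).trans_le (mul_le_of_le_one_left hR (div_self_le_one _))
  have hpq : inner ℝ q p = R * ‖q‖ := by
    rcases eq_or_ne q 0 with rfl | hq
    · rw [inner_zero_left, norm_zero, mul_zero]
    · rw [hp, inner_smul_right, real_inner_self_eq_norm_sq]
      field_simp
  have hpz := (ha z (left_mem_segment ..) p).trans (hH.le_upper p z)
  linarith [hH.upper_mono (norm_nonneg p) hR hpR]

lemma costDominated_of_lipschitz (hH : IsConvexCoerciveHamiltonian H νl νu) {u : Space d → ℝ}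
    {L : ℝ≥0} (hu : LipschitzWith L u) : CostDominated H (νu L) u := by
  intro t x y κ h
  induction h with
  | refl x => simp only [sub_self, zero_add, mul_zero, le_refl]
  | @step t x y κ _ s q b hs ha ih =>
    have hLip : u (y + s • q) - u y ≤ L * (s * ‖q‖) := by
      have h := (le_abs_self _).trans (hu.dist_le_mul (y + s • q) y)
      rwa [dist_eq_norm, add_sub_cancel_left, norm_smul, Real.norm_of_nonneg hs] at h
    have hcost : s * (L * ‖q‖) ≤ s * (b + νu L) :=
      mul_le_mul_of_nonneg_left (hH.mul_norm_le L.coe_nonneg ha) hs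
    linarith

lemma lower_zero_le (hH : IsConvexCoerciveHamiltonian H νl νu) {L : ℝ} (hL : 0 ≤ L) :
    νl 0 ≤ νu L := by
  have h := (hH.lower_le 0 0).trans (hH.le_upper 0 0)
  rw [norm_zero] at h
  exact h.trans (hH.upper_mono Set.self_mem_Ici hL hL)

lemma exists_lower_eq (hH : IsConvexCoerciveHamiltonian H νl νu) (L : ℝ≥0) :
    ∃ K : ℝ≥0, νl K = νu L := by
  obtain ⟨σ, hσ, hsupp⟩ := exists_pos_support_line hH.lower_convex hH.lower_strictMono one_pos
  set R : ℝ := 1 + |νu L - νl 1| / σ with hR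
  have hR0 : 0 ≤ R := by positivity
  have hLR : νu L ≤ νl R := by
    have hσR : σ * (R - 1) = |νu L - νl 1| := by
      rw [hR]
      field_simp
      ring
    linarith [hsupp R hR0, le_abs_self (νu L - νl 1)]
  have hcont : ContinuousOn νl (Set.Icc 0 R) := (continuousOn_Ici_of_convexOn_of_monotoneOn
    hH.lower_convex hH.lower_strictMono.monotoneOn).mono Set.Icc_subset_Ici_self
  obtain ⟨K, hK, hKL⟩ := intermediate_value_Icc hR0 hcont ⟨hH.lower_zero_le L.2, hLR⟩
  exact ⟨⟨K, hK.1⟩, hKL⟩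

/-- Running straight from `x` to `y` at the speed `σ` of a support line of `νl` at `R` costs
`σ * R - νl R` per unit of time. -/
lemma sub_le_of_costDominated (hH : IsConvexCoerciveHamiltonian H νl νu) {u : Space d → ℝ} {R : ℝ}
    (hR : 0 < R) (hu : CostDominated H (νl R) u) (x y : Space d) : u y - u x ≤ R * ‖y - x‖ := by
  obtain ⟨σ, hσ, hsupp⟩ := exists_pos_support_line hH.lower_convex hH.lower_strictMono hR
  rcases eq_or_ne y x with rfl | hxy
  · simp only [sub_self, norm_zero, mul_zero, le_refl]
  set n := ‖y - x‖ with hn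
  have hnpos : 0 < n := norm_pos_iff.2 (sub_ne_zero.2 hxy)
  set q : Space d := (σ / n) • (y - x) with hq
  have hqσ : ‖q‖ = σ := by
    rw [hq, norm_smul, Real.norm_of_nonneg (by positivity), ← hn, div_mul_cancel₀ _ hnpos.ne']
  have hadm : Admissible H q (σ * R - νl R) x (x + (n / σ) • q) := by
    intro z _ p
    have hinner := real_inner_le_norm q p
    rw [hqσ] at hinner
    linarith [hsupp ‖p‖ (norm_nonneg p), hH.lower_le p z]
  have hend : x + (n / σ) • q = y := by
    rw [hq, smul_smul, div_mul_div_cancel₀ hσ.ne', div_self hnpos.ne', one_smul,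
      add_sub_cancel]
  calc u y - u x ≤ n / σ * (σ * R - νl R) + νl R * (n / σ) :=
        hu ((Reach.single (by positivity) hadm).congr rfl hend rfl)
    _ = R * n := by
      field_simp
      ring

lemma lipschitz_of_costDominated (hH : IsConvexCoerciveHamiltonian H νl νu) {u : Space d → ℝ}
    {K : ℝ≥0} (hu : CostDominated H (νl K) u) : LipschitzWith K u := by
  have hsub : ∀ x y, u y - u x ≤ K * ‖y - x‖ := by
    intro x y
    refine ge_of_tendsto (((continuous_mul_const ‖y - x‖).tendsto (K : ℝ)).mono_left
      (nhdsWithin_le_nhds (s := Set.Ioi (K : ℝ)))) ?_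
    filter_upwards [self_mem_nhdsWithin] with R hR
    have hR0 : 0 < R := K.2.trans_lt hR
    exact hH.sub_le_of_costDominated hR0
      (hu.weaken (hH.lower_strictMono.monotoneOn K.2 hR0.le (le_of_lt hR))) x y
  refine LipschitzWith.of_dist_le_mul fun x y => ?_
  rw [Real.dist_eq, dist_eq_norm, abs_sub_le_iff]
  exact ⟨hsub y x, by rw [norm_sub_rev]; exact hsub x y⟩

lemma exists_locally_admissible (hH : IsConvexCoerciveHamiltonian H νl νu) (p₀ x₀ : Space d)
    {ε : ℝ} (hε : 0 < ε) :
    ∃ (q : Space d) (b : ℝ), H p₀ x₀ - ε ≤ inner ℝ q p₀ - b ∧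
      ∀ᶠ z in 𝓝 x₀, ∀ p, inner ℝ q p - b ≤ H p z := by
  obtain ⟨σ, hσ, hsupp⟩ := exists_pos_support_line hH.lower_convex hH.lower_strictMono one_pos
  have hcoer : ∀ p, σ * ‖p‖ - (σ - νl 1) ≤ H p x₀ := fun p => by
    linarith [hsupp ‖p‖ (norm_nonneg p), hH.lower_le p x₀]
  obtain ⟨q, b, δ, hδ, hp₀, hgap⟩ := exists_affine_add_gap_le (hH.convex x₀)
    (hH.continuous_uncurry.comp (Continuous.prodMk_left x₀)) hσ hcoer p₀ hε
  refine ⟨q, b, hp₀, ?_⟩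
  have hcont : Continuous fun w : Space d × Space d => H w.2 w.1 - (inner ℝ q w.2 - b) :=
    (hH.continuous_uncurry.comp continuous_swap).sub (by fun_prop)
  have hconv : ∀ z, ConvexOn ℝ Set.univ fun p => H p z - (inner ℝ q p - b) := fun z =>
    (hH.convex z).sub (((innerₛₗ ℝ q).concaveOn convex_univ).sub (convexOn_const b convex_univ))
  filter_upwards [eventually_forall_nonneg_of_convexOn hcont hconv (x₀ := x₀) hδ
    fun p => by linarith [hgap p]] with z hz p
  exact sub_nonneg.1 (hz p)

lemma mul_norm_sub_le (hH : IsConvexCoerciveHamiltonian H νl νu) {R t κ : ℝ} (hR : 0 ≤ R)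
    {x y : Space d} (h : Reach H t x y κ) : R * ‖y - x‖ ≤ κ + νu R * t := by
  lift R to ℝ≥0 using hR
  have hLip : LipschitzWith R fun y => R * ‖y - x‖ := by
    refine LipschitzWith.of_dist_le_mul fun y z => ?_
    rw [Real.dist_eq, ← mul_sub, abs_mul, abs_of_nonneg R.coe_nonneg, dist_eq_norm]
    exact mul_le_mul_of_nonneg_left
      ((abs_norm_sub_norm_le _ _).trans_eq (by rw [sub_sub_sub_cancel_right])) R.2
  simpa only [sub_self, norm_zero, mul_zero, sub_zero] using hH.costDominated_of_lipschitz hLip h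

lemma sub_le_and_norm_lt_or_le_cost (hH : IsConvexCoerciveHamiltonian H νl νu) {f : Space d → ℝ}
    (hf : Differentiable ℝ f) {r h K t κ : ℝ} (hr : 0 < r) (hK : 0 ≤ K) {x y : Space d}
    (hh : ∀ z, ‖z - x‖ < r → H (gradient f z) z ≤ h) (hxy : Reach H t x y κ) :
    (f y - f x ≤ κ + h * t ∧ ‖y - x‖ < r) ∨ r + K * ‖y - x‖ ≤ κ + νu (K + 1) * t := by
  induction hxy with
  | refl x => simp [hr]
  | @step t x y κ hreach s q b hs ha ih =>
    have hsq : ‖s • q‖ = s * ‖q‖ := by rw [norm_smul, Real.norm_of_nonneg hs]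
    have hcost : (K + 1) * (s * ‖q‖) ≤ s * b + νu (K + 1) * s := by
      linarith [mul_le_mul_of_nonneg_left (hH.mul_norm_le (by linarith : 0 ≤ K + 1) ha) hs]
    have hnorm : ‖y + s • q - x‖ ≤ ‖y - x‖ + s * ‖q‖ := by
      rw [← hsq, add_sub_right_comm]
      exact norm_add_le _ _
    have hKnorm := mul_le_mul_of_nonneg_left hnorm hK
    rcases ih hh with ⟨hfy, -⟩ | hexp
    · rcases lt_or_ge (‖y - x‖ + s * ‖q‖) r with hlt | hge
      · refine Or.inl ⟨?_, hnorm.trans_lt hlt⟩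
        have hmove := ha.sub_le hf hs (h := h) fun z hz => hh z <| by
          have hzy : ‖z - y‖ ≤ s * ‖q‖ := by
            simpa only [add_sub_cancel_left, hsq] using norm_sub_le_of_mem_segment hz
          linarith [norm_sub_le_norm_sub_add_norm_sub z y x]
        linarith
      · exact Or.inr (by linarith [hH.mul_norm_sub_le (by linarith : 0 ≤ K + 1) hreach])
    · exact Or.inr (by linarith [mul_nonneg hs (norm_nonneg q)])

end IsConvexCoerciveHamiltonian

section TestFunctions

variable {E : Type*} [NormedAddCommGroup E] [InnerProductSpace ℝ E] {φ : E × ℝ → ℝ}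

lemma hasDerivAt_time (hφ : ContDiff ℝ 1 φ) (x : E) (t : ℝ) :
    HasDerivAt (fun s => φ (x, s)) (fderiv ℝ φ (x, t) (0, 1)) t :=
  (hφ.differentiable one_ne_zero (x, t)).hasFDerivAt.comp_hasDerivAt t
    ((hasDerivAt_const t x).prodMk (hasDerivAt_id t))

lemma continuous_deriv_time (hφ : ContDiff ℝ 1 φ) :
    Continuous fun q : E × ℝ => deriv (fun s => φ (q.1, s)) q.2 := by
  simp_rw [fun q : E × ℝ => (hasDerivAt_time hφ q.1 q.2).deriv]
  exact (hφ.continuous_fderiv one_ne_zero).clm_apply continuous_const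

variable [CompleteSpace E]

lemma hasGradientAt_space (hφ : ContDiff ℝ 1 φ) (x : E) (t : ℝ) :
    HasGradientAt (fun y => φ (y, t)) ((InnerProductSpace.toDual ℝ E).symm
      ((fderiv ℝ φ (x, t)).comp (ContinuousLinearMap.inl ℝ E ℝ))) x := by
  rw [hasGradientAt_iff_hasFDerivAt, LinearIsometryEquiv.apply_symm_apply]
  exact (hφ.differentiable one_ne_zero (x, t)).hasFDerivAt.comp x (hasFDerivAt_prodMk_left x t)

lemma continuous_gradient_space (hφ : ContDiff ℝ 1 φ) :
    Continuous fun q : E × ℝ => gradient (fun y => φ (y, q.2)) q.1 := by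
  simp_rw [fun q : E × ℝ => (hasGradientAt_space hφ q.1 q.2).gradient]
  exact (InnerProductSpace.toDual ℝ E).symm.continuous.comp
    ((hφ.continuous_fderiv one_ne_zero).clm_comp continuous_const)

lemma hasDerivAt_along_curve (hφ : ContDiff ℝ 1 φ) {γ : ℝ → E} {x q : E} {t : ℝ}
    (hγ : HasDerivAt γ q t) (hx : γ t = x) :
    HasDerivAt (fun s => φ (γ s, s))
      (inner ℝ (gradient (fun y => φ (y, t)) x) q + deriv (fun s => φ (x, s)) t) t := by
  subst hx
  have hsplit : inner ℝ (gradient (fun y => φ (y, t)) (γ t)) q + deriv (fun s => φ (γ t, s)) t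
      = fderiv ℝ φ (γ t, t) (q, 1) := by
    rw [(hasGradientAt_space hφ (γ t) t).gradient, (hasDerivAt_time hφ (γ t) t).deriv,
      InnerProductSpace.toDual_symm_apply, ContinuousLinearMap.comp_apply,
      ContinuousLinearMap.inl_apply, ← map_add, Prod.mk_add_mk, add_zero, zero_add]
  rw [hsplit]
  exact (hφ.differentiable one_ne_zero (γ t, t)).hasFDerivAt.comp_hasDerivAt
    (f := fun s => (γ s, id s)) t (hγ.prodMk (hasDerivAt_id t))

end TestFunctions

section OneSidedCalculus

variable {f : ℝ → ℝ} {f' t : ℝ}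

lemma nonpos_of_hasDerivAt_of_eventually_le_left (hf : HasDerivAt f f' t)
    (h : ∀ᶠ s in 𝓝[<] t, f t ≤ f s) : f' ≤ 0 := by
  refine le_of_tendsto (hasDerivAt_iff_tendsto_slope_left_right.1 hf).1 ?_
  filter_upwards [h, self_mem_nhdsWithin] with s hs hst
  rw [slope_def_field]
  exact div_nonpos_of_nonneg_of_nonpos (sub_nonneg.2 hs) (sub_nonpos.2 (le_of_lt hst))

lemma eventually_forall_mem_Icc_left {p : ℝ → Prop} (h : ∀ᶠ r in 𝓝 t, p r) :
    ∀ᶠ s in 𝓝[<] t, ∀ r ∈ Set.Icc s t, p r :=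
  ((tendsto_id'.2 nhdsWithin_le_nhds).Icc tendsto_const_nhds).eventually
    (eventually_smallSets_forall.2 h)

lemma continuousAt_deriv_of_contDiffAt (hf : ContDiffAt ℝ 1 f t) : ContinuousAt (deriv f) t :=
  (hf.derivWithin (m := 0) (by norm_num)).continuousAt

lemma eventually_monotoneOn_left (hf : ContDiffAt ℝ 1 f t) (h : 0 < deriv f t) :
    ∀ᶠ s in 𝓝[<] t, MonotoneOn f (Set.Icc s t) := by
  have hpos : ∀ᶠ s in 𝓝 t, DifferentiableAt ℝ f s ∧ 0 ≤ deriv f s := by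
    filter_upwards [hf.eventually (by norm_num),
      (continuousAt_deriv_of_contDiffAt hf).eventually_const_lt h] with s hs hs'
      using ⟨hs.differentiableAt one_ne_zero, hs'.le⟩
  filter_upwards [eventually_forall_mem_Icc_left hpos] with s hs
  exact monotoneOn_of_deriv_nonneg (convex_Icc s t)
    (fun r hr => (hs r hr).1.continuousAt.continuousWithinAt)
    (fun r hr => (hs r (interior_subset hr)).1.differentiableWithinAt)
    (fun r hr => (hs r (interior_subset hr)).2)

lemma eventually_antitoneOn_left (hf : ContDiffAt ℝ 1 f t) (h : deriv f t < 0) :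
    ∀ᶠ s in 𝓝[<] t, AntitoneOn f (Set.Icc s t) := by
  filter_upwards [eventually_monotoneOn_left hf.neg (by rwa [deriv.fun_neg, neg_pos])] with s hs
  simpa only [neg_neg] using hs.neg

end OneSidedCalculus

section PathExtension

variable {ζ : C(ℝ≥0, ℝ)} {s t : ℝ}

lemma pathExt_coe (ζ : C(ℝ≥0, ℝ)) (r : ℝ≥0) : pathExt ζ r = ζ r := by
  rw [pathExt, Real.toNNReal_coe]

lemma coe_mem_Icc_of_mem_Icc_toNNReal (ht : 0 ≤ t) {r : ℝ≥0}
    (hr : r ∈ Set.Icc s.toNNReal t.toNNReal) : (r : ℝ) ∈ Set.Icc s t :=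
  ⟨Real.toNNReal_le_iff_le_coe.1 hr.1, (Real.le_toNNReal_iff_coe_le ht).1 hr.2⟩

lemma monotoneOn_of_pathExt (ht : 0 ≤ t) (h : MonotoneOn (pathExt ζ) (Set.Icc s t)) :
    MonotoneOn ζ (Set.Icc s.toNNReal t.toNNReal) := by
  intro a ha b hb hab
  rw [← pathExt_coe, ← pathExt_coe]
  exact h (coe_mem_Icc_of_mem_Icc_toNNReal ht ha) (coe_mem_Icc_of_mem_Icc_toNNReal ht hb)
    (NNReal.coe_le_coe.2 hab)

lemma antitoneOn_of_pathExt (ht : 0 ≤ t) (h : AntitoneOn (pathExt ζ) (Set.Icc s t)) :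
    AntitoneOn ζ (Set.Icc s.toNNReal t.toNNReal) := by
  have hneg : MonotoneOn (-ζ) (Set.Icc s.toNNReal t.toNNReal) :=
    monotoneOn_of_pathExt (ζ := -ζ) ht h.neg
  simpa using hneg.neg

end PathExtension

section TouchingFromAbove

variable {d : ℕ} {H : Space d → Space d → ℝ} {νl νu : ℝ → ℝ} {U : ℝ → Space d → ℝ}
  {Z : ℝ → ℝ} {Z' c t : ℝ} {x : Space d} {φ : Space d × ℝ → ℝ}

lemma deriv_nonpos_of_isLocalMax (hφ : ContDiff ℝ 1 φ)
    (hmax : IsLocalMax (fun q : Space d × ℝ => U q.2 q.1 - φ q) (x, t))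
    (hU : ∀ ε > 0, ∀ᶠ s in 𝓝[<] t, U t x ≤ U s x + ε * (t - s)) :
    deriv (fun s => φ (x, s)) t ≤ 0 := by
  refine le_of_forall_pos_le_add fun ε hε => ?_
  have hφt := (hasDerivAt_time hφ x t).differentiableAt.hasDerivAt
  have htouch := (tendsto_const_nhds.prodMk_nhds (tendsto_id'.2 nhdsWithin_le_nhds) :
    Tendsto (fun s => (x, s)) (𝓝[<] t) (𝓝 (x, t))).eventually hmax
  have hnonpos := nonpos_of_hasDerivAt_of_eventually_le_left
    (hφt.add (((hasDerivAt_id t).const_sub t).const_mul ε)) (by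
      filter_upwards [htouch, hU ε hε] with s hmax_s hUs
      simp only [Pi.add_apply, id, sub_self, mul_zero]
      linarith)
  linarith

/-- The value is compared with that of a single admissible move. -/
lemma deriv_le_of_eventually_eq_backwardFlow (hH : IsConvexCoerciveHamiltonian H νl νu)
    (hφ : ContDiff ℝ 1 φ)
    (hmax : IsLocalMax (fun q : Space d × ℝ => U q.2 q.1 - φ q) (x, t))
    (hZ : HasDerivAt Z Z' t) (hZ' : Z' ≤ 0) (hc : ∀ s, CostDominated H c (U s))
    (hU : ∀ᶠ s in 𝓝[<] t, 0 ≤ Z s - Z t ∧ U t = backwardFlow H (Z s - Z t) (U s)) :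
    deriv (fun s => φ (x, s)) t ≤ H (gradient (fun y => φ (y, t)) x) x * Z' := by
  set P := gradient (fun y => φ (y, t)) x with hP
  suffices hlt : ∀ h < H P x, deriv (fun s => φ (x, s)) t ≤ h * Z' from
    ge_of_tendsto (((continuous_mul_const Z').tendsto (H P x)).mono_left nhdsWithin_le_nhds)
      (eventually_mem_nhdsWithin.mono hlt : ∀ᶠ h in 𝓝[<] H P x, _)
  intro h hh
  obtain ⟨q, b, hqb, hadm⟩ := hH.exists_locally_admissible P x (sub_pos.2 hh)
  have hγ : HasDerivAt (fun s => x - (Z s - Z t) • q) (-(Z' • q)) t :=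
    ((hZ.sub_const (Z t)).smul_const q).const_sub x
  have hγt : Tendsto (fun s => x - (Z s - Z t) • q) (𝓝[<] t) (𝓝 x) := by
    simpa only [sub_self, zero_smul, sub_zero] using
      hγ.continuousAt.tendsto.mono_left (nhdsWithin_le_nhds (s := Set.Iio t))
  have htouch := (hγt.prodMk_nhds (tendsto_id'.2 nhdsWithin_le_nhds)).eventually hmax
  obtain ⟨δ, hδ, hball⟩ := Metric.eventually_nhds_iff_ball.1 hadm
  have hnonpos := nonpos_of_hasDerivAt_of_eventually_le_left
    ((hasDerivAt_along_curve hφ hγ (x := x) (by simp)).add ((hZ.sub_const (Z t)).mul_const b)) (by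
      filter_upwards [htouch, hγt.eventually (Metric.ball_mem_nhds x hδ), hU]
        with s hmax_s hγs ⟨hτ, hUs⟩
      have hend : x - (Z s - Z t) • q + (Z s - Z t) • q = x := sub_add_cancel ..
      have hmove : Admissible H q b (x - (Z s - Z t) • q)
          (x - (Z s - Z t) • q + (Z s - Z t) • q) := by
        rw [hend]
        exact fun z hz => hball z
          ((convex_ball x δ).segment_subset hγs (Metric.mem_ball_self hδ) hz)
      have hle := (hc s).backwardFlow_le ((Reach.single hτ hmove).congr rfl hend rfl)
      rw [← hUs] at hle
      simp only [id] at hmax_s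
      simp only [Pi.add_apply, sub_self, zero_smul, sub_zero, zero_mul, add_zero]
      linarith)
  rw [inner_neg_right, inner_smul_right, real_inner_comm] at hnonpos
  have hbound := mul_le_mul_of_nonpos_left hqb hZ'
  rw [← hP] at hnonpos
  linarith

lemma forwardFlow_le_of_touching (hH : IsConvexCoerciveHamiltonian H νl νu) {K : ℝ≥0}
    {w f : Space d → ℝ} (hw : CostDominated H (νl K) w) (hf : Differentiable ℝ f)
    {A h r η τ : ℝ} (hr : 0 < r) (hη : 0 < η) (hτ : 0 ≤ τ)
    (hh : ∀ z, ‖z - x‖ < r → H (gradient f z) z ≤ h)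
    (htouch : ∀ z, ‖z - x‖ < r → w z - f z ≤ A)
    (hsmall : (νu (K + 1) + (νl 0)⁻) * τ + η < r) :
    forwardFlow H τ w x ≤ A + f x + h * τ + η := by
  obtain ⟨y, κ, hreach, hopt⟩ := exists_lt_of_lt_forwardFlow hH.neg_negPart_le hτ
    (sub_lt_self (forwardFlow H τ w x) hη)
  rcases hH.sub_le_and_norm_lt_or_le_cost hf hr K.coe_nonneg hh hreach with ⟨hfy, hyr⟩ | hexp
  · linarith [htouch y hyr]
  · have hLip : w y - w x ≤ K * ‖y - x‖ := by
      rw [← dist_eq_norm]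
      exact (le_abs_self _).trans ((hH.lipschitz_of_costDominated hw).dist_le_mul y x)
    linarith [hw.le_forwardFlow_add hH.neg_negPart_le hτ x]

/-- Chains that are nearly optimal for the value stay close to `x`. -/
lemma deriv_le_of_eventually_eq_forwardFlow (hH : IsConvexCoerciveHamiltonian H νl νu)
    (hφ : ContDiff ℝ 1 φ)
    (hmax : IsLocalMax (fun q : Space d × ℝ => U q.2 q.1 - φ q) (x, t))
    (hZ : HasDerivAt Z Z' t) {K : ℝ≥0} (hK : ∀ s, CostDominated H (νl K) (U s))
    (hU : ∀ᶠ s in 𝓝[<] t, 0 ≤ Z t - Z s ∧ U t = forwardFlow H (Z t - Z s) (U s)) :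
    deriv (fun s => φ (x, s)) t ≤ H (gradient (fun y => φ (y, t)) x) x * Z' := by
  set P := gradient (fun y => φ (y, t)) x
  suffices hgt : ∀ h > H P x, deriv (fun s => φ (x, s)) t ≤ h * Z' from
    ge_of_tendsto (((continuous_mul_const Z').tendsto (H P x)).mono_left nhdsWithin_le_nhds)
      (eventually_mem_nhdsWithin.mono hgt : ∀ᶠ h in 𝓝[>] H P x, _)
  intro h hh
  have hHcont : Continuous fun q : Space d × ℝ => H (gradient (fun y => φ (y, q.2)) q.1) q.1 :=
    hH.continuous_uncurry.comp ((continuous_gradient_space hφ).prodMk continuous_fst)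
  obtain ⟨r, hr, hball⟩ := Metric.eventually_nhds_iff_ball.1
    (((hHcont.tendsto (x, t)).eventually_lt_const hh).and hmax)
  have hsmall : ∀ᶠ s in 𝓝[<] t,
      (νu (K + 1) + (νl 0)⁻) * (Z t - Z s) + (t - s) ^ 2 < r := by
    have hcont : ContinuousAt
        (fun s => (νu (K + 1) + (νl 0)⁻) * (Z t - Z s) + (t - s) ^ 2) t :=
      (continuousAt_const.mul (continuousAt_const.sub hZ.continuousAt)).add (by fun_prop)
    exact nhdsWithin_le_nhds (hcont.tendsto.eventually_lt_const (by simpa using hr))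
  have hφt := (hasDerivAt_time hφ x t).differentiableAt.hasDerivAt
  have hnonpos := nonpos_of_hasDerivAt_of_eventually_le_left
    ((hφt.add ((hZ.const_sub (Z t)).const_mul h)).add
      (((hasDerivAt_id t).const_sub t).pow 2)) (by
      filter_upwards [hU, Ioo_mem_nhdsLT (sub_lt_self t hr), hsmall]
        with s ⟨hτ, hUs⟩ ⟨hrs, hst⟩ hs
      have hmem : ∀ z, ‖z - x‖ < r → (z, s) ∈ Metric.ball (x, t) r := fun z hz => by
        rw [Metric.mem_ball, Prod.dist_eq, max_lt_iff, dist_eq_norm, Real.dist_eq, abs_lt]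
        exact ⟨hz, by linarith, by linarith⟩
      have hle := forwardFlow_le_of_touching hH (hK s)
        (fun y => (hasGradientAt_space hφ y s).differentiableAt) hr
        (pow_pos (sub_pos.2 hst) 2) hτ (fun z hz => (hball (z, s) (hmem z hz)).1.le)
        (fun z hz => (hball (z, s) (hmem z hz)).2) hs
      rw [← hUs] at hle
      simp only [Pi.add_apply, Pi.pow_apply, id, sub_self, mul_zero]
      linarith)
  norm_num at hnonpos
  linarith

end TouchingFromAbove

namespace CostDominated

variable {d : ℕ} {H : Space d → Space d → ℝ} {νl νu : ℝ → ℝ} {u₀ : Space d → ℝ}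
  {ζ : C(ℝ≥0, ℝ)} {m c t : ℝ}

lemma eventually_pathFlow_le_of_deriv_eq_zero (hm0 : 0 ≤ m) (hm : ∀ p x, -m ≤ H p x)
    (hu : CostDominated H c u₀) (ht : 0 ≤ t) (hζ : HasDerivAt (pathExt ζ) 0 t) (x : Space d) {ε : ℝ}
    (hε : 0 < ε) : ∀ᶠ s in 𝓝[<] t, pathFlow H ζ u₀ t.toNNReal x ≤
      pathFlow H ζ u₀ s.toNNReal x + ε * (t - s) := by
  obtain ⟨δ, hδ, hδε⟩ := exists_pos_mul_lt hε ((c + 2 * m) * 2)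
  have hlin : ∀ᶠ r in 𝓝 t, |pathExt ζ r - pathExt ζ t| ≤ δ * |r - t| := by
    simpa only [smul_zero, sub_zero, Real.norm_eq_abs] using
      (hasDerivAt_iff_isLittleO.1 hζ).def hδ
  filter_upwards [eventually_forall_mem_Icc_left hlin, self_mem_nhdsWithin] with s hs hst
  have hst' : s < t := hst
  have hosc : ∀ r ∈ Set.Icc s t, |pathExt ζ r - pathExt ζ t| ≤ δ * (t - s) := fun r hr =>
    (hs r hr).trans (mul_le_mul_of_nonneg_left
      (by rw [abs_sub_comm, abs_of_nonneg] <;> linarith [hr.1, hr.2]) hδ.le)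
  have hflow := hu.abs_pathFlow_sub_le hm0 hm (ζ := ζ) (M := 2 * (δ * (t - s)))
    (Real.toNNReal_mono hst'.le) (fun r hsr hrt => by
      have hr := hosc r (coe_mem_Icc_of_mem_Icc_toNNReal ht ⟨hsr, hrt⟩)
      have hs := hosc s (Set.left_mem_Icc.2 hst'.le)
      rw [abs_sub_comm] at hs
      rw [pathExt_coe] at hr
      rw [two_mul]
      exact (abs_sub_le _ _ _).trans (add_le_add hr hs)) x
  have hscale := mul_le_mul_of_nonneg_right hδε.le (sub_nonneg.2 hst'.le)
  linarith [(abs_sub_le_iff.1 hflow).1]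

lemma pathFlow_subsolution (hH : IsConvexCoerciveHamiltonian H νl νu) {K : ℝ≥0}
    (hu : CostDominated H (νl K) u₀) {u : C(Space d × ℝ≥0, ℝ)}
    (hU : ∀ x t, u (x, t) = pathFlow H ζ u₀ t x) : IsViscositySubsolution H ζ u := by
  intro φ hφ x t ht hζ hmax
  have hm := hH.neg_negPart_le
  have hm0 := negPart_nonneg (νl 0)
  simp only [hU] at hmax
  have hdom : ∀ s : ℝ, CostDominated H (νl K) (pathFlow H ζ u₀ s.toNNReal) :=
    fun s => hu.pathFlow hm0 hm ζ _
  have hderiv : HasDerivAt (pathExt ζ) (deriv (pathExt ζ) t) t :=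
    (hζ.differentiableAt one_ne_zero).hasDerivAt
  rcases lt_trichotomy (deriv (pathExt ζ) t) 0 with hneg | hzero | hpos
  · refine deriv_le_of_eventually_eq_backwardFlow hH hφ hmax hderiv hneg.le hdom ?_
    filter_upwards [eventually_antitoneOn_left hζ hneg, self_mem_nhdsWithin] with s hanti hst
    have hst' : s ≤ t := le_of_lt hst
    have hτ : pathExt ζ t - pathExt ζ s ≤ 0 :=
      sub_nonpos.2 (hanti (Set.left_mem_Icc.2 hst') (Set.right_mem_Icc.2 hst') hst')
    refine ⟨by linarith, ?_⟩
    rw [hu.pathFlow_of_monotoneOn hm0 hm (Real.toNNReal_mono hst')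
      (Or.inr (antitoneOn_of_pathExt ht.le hanti)), ← neg_sub (pathExt ζ t)]
    exact flowStep_of_nonpos hτ _
  · rw [hzero] at hderiv
    rw [hzero, mul_zero]
    exact deriv_nonpos_of_isLocalMax (U := fun s => pathFlow H ζ u₀ s.toNNReal) hφ hmax
      fun ε hε => hu.eventually_pathFlow_le_of_deriv_eq_zero hm0 hm ht.le hderiv x hε
  · refine deriv_le_of_eventually_eq_forwardFlow hH hφ hmax hderiv hdom ?_
    filter_upwards [eventually_monotoneOn_left hζ hpos, self_mem_nhdsWithin] with s hmono hst
    have hst' : s ≤ t := le_of_lt hst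
    have hτ : 0 ≤ pathExt ζ t - pathExt ζ s :=
      sub_nonneg.2 (hmono (Set.left_mem_Icc.2 hst') (Set.right_mem_Icc.2 hst') hst')
    refine ⟨hτ, ?_⟩
    rw [hu.pathFlow_of_monotoneOn hm0 hm (Real.toNNReal_mono hst')
      (Or.inl (monotoneOn_of_pathExt ht.le hmono))]
    exact flowStep_of_nonneg hτ _

end CostDominated

section DoublingOfVariables

lemma le_of_mapClusterPt {X ι : Type*} [TopologicalSpace X] {l : Filter ι} {w : ι → X} {x : X}
    {F : X → ℝ} {a : ℝ} (hF : Continuous F) (hx : MapClusterPt x l w)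
    (h : ∀ b < a, ∀ᶠ n in l, b ≤ F (w n)) : a ≤ F x :=
  le_of_forall_lt_imp_le_of_dense fun b hb =>
    isClosed_iff_clusterPt.1 (isClosed_le continuous_const hF) x
      (ClusterPt.mono hx (le_principal_iff.2 (h b hb)))

lemma exists_doubled_maximizers {X : Type*} [TopologicalSpace X] {f g : X → ℝ} {P : X × X → ℝ}
    (hf : Continuous f) (hg : Continuous g) (hP : Continuous P) (hP0 : ∀ q, 0 ≤ P q)
    (hPd : ∀ a b, P (a, b) = 0 ↔ a = b) {S : Set X} (hS : IsCompact S) {z₀ : X} (hz₀ : z₀ ∈ S)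
    (hmax : ∀ z ∈ S, f z₀ - g z₀ ≤ f z - g z → z = z₀) :
    ∃ w : ℕ → X × X, Tendsto w atTop (𝓝 (z₀, z₀)) ∧ (∀ n, w n ∈ S ×ˢ S) ∧
      ∀ n, ∀ q ∈ S ×ˢ S, f q.1 - g q.2 - n * P q ≤ f (w n).1 - g (w n).2 - n * P (w n) := by
  have hF : Continuous fun q : X × X => f q.1 - g q.2 :=
    (hf.comp continuous_fst).sub (hg.comp continuous_snd)
  have hSS := hS.prod hS
  have hex : ∀ n : ℕ, ∃ w ∈ S ×ˢ S, ∀ q ∈ S ×ˢ S,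
      f q.1 - g q.2 - n * P q ≤ f w.1 - g w.2 - n * P w := fun n =>
    hSS.exists_isMaxOn ⟨(z₀, z₀), hz₀, hz₀⟩ (hF.sub (hP.const_mul (n : ℝ))).continuousOn
  choose w hwS hwmax using hex
  refine ⟨w, ?_, hwS, hwmax⟩
  have hge : ∀ n : ℕ, f z₀ - g z₀ + n * P (w n) ≤ f (w n).1 - g (w n).2 := fun n => by
    have hle := hwmax n (z₀, z₀) ⟨hz₀, hz₀⟩
    rw [(hPd z₀ z₀).2 rfl, mul_zero, sub_zero] at hle
    exact le_sub_iff_add_le.1 hle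
  obtain ⟨C, hC⟩ := hSS.bddAbove_image hF.continuousOn
  have hPC : Tendsto (fun n : ℕ => (C - (f z₀ - g z₀)) / n) atTop (𝓝 0) :=
    tendsto_const_div_atTop_nhds_zero_nat _
  refine hSS.tendsto_nhds_of_unique_mapClusterPt (Eventually.of_forall hwS) ?_
  rintro ⟨a, b⟩ ⟨ha, -⟩ hab
  have hPab : 0 ≤ -P (a, b) :=
    le_of_mapClusterPt (F := fun q => -P q) hP.neg hab fun c hc => by
      filter_upwards [hPC.eventually_lt_const (neg_pos.2 hc), eventually_gt_atTop 0] with n hn hn0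
      have hn0' : (0 : ℝ) < n := Nat.cast_pos.2 hn0
      have hlt := (div_lt_iff₀ hn0').1 hn
      have hle := hC (Set.mem_image_of_mem _ (hwS n))
      refine le_neg.1 (le_of_mul_le_mul_left ?_ hn0')
      linarith [hge n]
  obtain rfl := (hPd a b).1 (le_antisymm (neg_nonneg.1 hPab) (hP0 _))
  obtain rfl := hmax a ha <|
    le_of_mapClusterPt (F := fun q : X × X => f q.1 - g q.2) hF hab fun c hc =>
      Eventually.of_forall fun n => hc.le.trans
        ((le_add_of_nonneg_right (mul_nonneg n.cast_nonneg (hP0 _))).trans (hge n))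
  rfl

end DoublingOfVariables

section SquaredDistance

variable {E : Type*} [NormedAddCommGroup E]

/-- The squared Hilbert space distance on `E × ℝ`, whose own norm is the sup norm. It penalizes the
distance of the doubled variables and makes local maxima strict. -/
def sqDist (z w : E × ℝ) : ℝ := ‖z.1 - w.1‖ ^ 2 + (z.2 - w.2) ^ 2

lemma sqDist_nonneg (z w : E × ℝ) : 0 ≤ sqDist z w :=
  add_nonneg (sq_nonneg _) (sq_nonneg _)

lemma sqDist_comm (z w : E × ℝ) : sqDist z w = sqDist w z := by
  rw [sqDist, sqDist, norm_sub_rev, sub_sq_comm]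

lemma sqDist_eq_zero {z w : E × ℝ} : sqDist z w = 0 ↔ z = w := by
  rw [sqDist, add_eq_zero_iff_of_nonneg (sq_nonneg _) (sq_nonneg _), sq_eq_zero_iff,
    sq_eq_zero_iff, norm_eq_zero, sub_eq_zero, sub_eq_zero, Prod.ext_iff]

lemma sqDist_self (z : E × ℝ) : sqDist z z = 0 := sqDist_eq_zero.2 rfl

lemma continuous_sqDist : Continuous fun q : (E × ℝ) × E × ℝ => sqDist q.1 q.2 := by
  unfold sqDist
  fun_prop

variable [InnerProductSpace ℝ E] {φ : E × ℝ → ℝ}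

lemma contDiff_add_mul_sqDist (hφ : ContDiff ℝ 1 φ) (c : ℝ) (w : E × ℝ) :
    ContDiff ℝ 1 fun z => φ z + c * sqDist z w :=
  hφ.add (contDiff_const.mul (((contDiff_fst.sub contDiff_const).norm_sq ℝ).add
    ((contDiff_snd.sub contDiff_const).pow 2)))

lemma deriv_add_mul_sqDist (hφ : ContDiff ℝ 1 φ) (c : ℝ) (w : E × ℝ) (x : E) (t : ℝ) :
    deriv (fun s => φ (x, s) + c * sqDist (x, s) w) t
      = deriv (fun s => φ (x, s)) t + 2 * c * (t - w.2) := by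
  have hsq : HasDerivAt (fun s => c * sqDist (x, s) w) (2 * c * (t - w.2)) t :=
    (((((hasDerivAt_id t).sub_const w.2).pow 2).const_add (‖x - w.1‖ ^ 2)).const_mul c).congr_deriv
      (by simp; ring)
  exact ((hasDerivAt_time hφ x t).differentiableAt.hasDerivAt.add hsq).deriv

lemma gradient_add_mul_sqDist [CompleteSpace E] (hφ : ContDiff ℝ 1 φ) (c : ℝ) (w : E × ℝ) (x : E)
    (t : ℝ) : gradient (fun y => φ (y, t) + c * sqDist (y, t) w) x
      = gradient (fun y => φ (y, t)) x + (2 * c) • (x - w.1) := by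
  have hsq : HasFDerivAt (fun y => c * sqDist (y, t) w) (c • 2 • innerSL ℝ (x - w.1)) x :=
    (((hasStrictFDerivAt_norm_sq (x - w.1)).hasFDerivAt.comp x
      ((hasFDerivAt_id x).sub_const w.1)).add_const ((t - w.2) ^ 2)).const_mul c
  refine HasGradientAt.gradient (hasGradientAt_iff_hasFDerivAt.2
    (((hasGradientAt_space hφ x t).differentiableAt.hasGradientAt.hasFDerivAt.add hsq).congr_fderiv
      ?_))
  ext y
  simp
  ring

end SquaredDistance

section DoublingSolutions

variable {d : ℕ} {H : Space d → Space d → ℝ} {νl νu : ℝ → ℝ} {ζ : C(ℝ≥0, ℝ)}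
  {u v : C(Space d × ℝ≥0, ℝ)} {F G ψ : Space d × ℝ → ℝ} {x y : Space d} {s t : ℝ} {K : ℝ≥0}

/-- A function on `ℝ^d × [0, ∞)`, extended to negative times by its initial values in the same way
as `pathExt` extends a path. -/
def timeExt (u : C(Space d × ℝ≥0, ℝ)) (q : Space d × ℝ) : ℝ := u (q.1, q.2.toNNReal)

lemma continuous_timeExt (u : C(Space d × ℝ≥0, ℝ)) : Continuous (timeExt u) :=
  u.continuous.comp (continuous_fst.prodMk (continuous_real_toNNReal.comp continuous_snd))

lemma deriv_le_of_isLocalMax_doubled (hu : IsViscositySubsolution H ζ u)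
    (hv : IsViscositySupersolution H ζ v) (hψ : ContDiff ℝ 1 ψ) (ht : 0 < t) (hs : 0 < s)
    (hζt : ContDiffAt ℝ 1 (pathExt ζ) t) (hζs : ContDiffAt ℝ 1 (pathExt ζ) s) (n : ℝ)
    (hmax : IsLocalMax (fun q => timeExt u q - (ψ q + n * sqDist q (y, s))) (x, t))
    (hmin : IsLocalMin (fun q => timeExt v q - (0 + -n * sqDist q (x, t))) (y, s)) :
    deriv (fun r => ψ (x, r)) t ≤
      H (gradient (fun z => ψ (z, t)) x + (2 * n) • (x - y)) x * deriv (pathExt ζ) t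
        - H ((2 * n) • (x - y)) y * deriv (pathExt ζ) s := by
  have hsub := hu _ (contDiff_add_mul_sqDist hψ n (y, s)) x t ht hζt hmax
  have hsup := hv _ (contDiff_add_mul_sqDist contDiff_const (-n) (x, t)) y s hs hζs hmin
  have hp : (2 * -n) • (y - x) = (2 * n) • (x - y) := by
    rw [mul_neg, neg_smul, ← smul_neg, neg_sub]
  rw [deriv_add_mul_sqDist hψ, gradient_add_mul_sqDist hψ] at hsub
  rw [deriv_add_mul_sqDist contDiff_const, gradient_add_mul_sqDist contDiff_const, hp,
    gradient_fun_const, deriv_const, zero_add, zero_add] at hsup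
  linarith

lemma norm_smul_sub_le_of_doubled_max (hG : LipschitzWith K fun y => G (y, s)) {n : ℝ}
    (hn : 0 ≤ n) (h : n * sqDist (x, t) (y, s) + G (y, s) ≤ n * sqDist (x, t) (x, s) + G (x, s)) :
    ‖(2 * n) • (x - y)‖ ≤ 2 * K := by
  have hG' : G (x, s) - G (y, s) ≤ K * ‖x - y‖ := by
    simpa only [Real.dist_eq, dist_eq_norm] using (le_abs_self _).trans (hG.dist_le_mul x y)
  rw [norm_smul, Real.norm_of_nonneg (by positivity), mul_assoc]
  refine mul_le_mul_of_nonneg_left ?_ zero_le_two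
  simp only [sqDist, sub_self, norm_zero] at h
  rcases (norm_nonneg (x - y)).eq_or_lt with h0 | h0
  · rw [← h0, mul_zero]
    exact K.coe_nonneg
  · exact le_of_mul_le_mul_right (by linarith) h0

lemma exists_doubled_touching_sequence (hF : Continuous F) (hG : Continuous G)
    (hψ : Continuous ψ) (hGK : ∀ s, LipschitzWith K fun y => G (y, s)) {z₀ : Space d × ℝ}
    (hmax : IsLocalMax (fun q => F q - G q - ψ q) z₀) :
    ∃ w : ℕ → (Space d × ℝ) × Space d × ℝ, Tendsto w atTop (𝓝 (z₀, z₀)) ∧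
      ∀ᶠ n : ℕ in atTop,
        IsLocalMax (fun q => F q - (ψ q + 1 * sqDist q z₀ + n * sqDist q (w n).2)) (w n).1 ∧
        IsLocalMin (fun q => G q - (0 + -n * sqDist q (w n).1)) (w n).2 ∧
        ‖(2 * n : ℝ) • ((w n).1.1 - (w n).2.1)‖ ≤ 2 * K := by
  obtain ⟨r, hr, hball⟩ := Metric.eventually_nhds_iff_ball.1 hmax
  set S := Metric.closedBall z₀ (r / 2) with hS
  have hnhds : S ∈ 𝓝 z₀ := Metric.closedBall_mem_nhds _ (half_pos hr)
  obtain ⟨w, hw, hwS, hwmax⟩ := exists_doubled_maximizers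
    (f := fun q => F q - (ψ q + 1 * sqDist q z₀)) (P := fun q => sqDist q.1 q.2) (S := S)
    (hF.sub (hψ.add (continuous_const.mul (continuous_sqDist.comp (.prodMk_left z₀))))) hG
    continuous_sqDist (fun q => sqDist_nonneg _ _) (fun _ _ => sqDist_eq_zero)
    (isCompact_closedBall z₀ (r / 2)) (mem_of_mem_nhds hnhds) fun z hz hle => by
      have hle' := hball z (Metric.closedBall_subset_ball (half_lt_self hr) hz)
      rw [sqDist_self] at hle
      exact sqDist_eq_zero.1 (le_antisymm (by linarith) (sqDist_nonneg z z₀))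
  refine ⟨w, hw, ?_⟩
  have hint : ∀ᶠ n in atTop, S ∈ 𝓝 (w n).1 ∧ S ∈ 𝓝 (w n).2 :=
    (hw.fst_nhds.eventually (eventually_mem_nhds_iff.2 hnhds)).and
      (hw.snd_nhds.eventually (eventually_mem_nhds_iff.2 hnhds))
  filter_upwards [hint] with n ⟨hn₁, hn₂⟩
  refine ⟨?_, ?_, ?_⟩
  · filter_upwards [hn₁] with q hq
    have := hwmax n (q, (w n).2) ⟨hq, (hwS n).2⟩
    dsimp only at this
    linarith
  · filter_upwards [hn₂] with q hq
    have := hwmax n ((w n).1, q) ⟨(hwS n).1, hq⟩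
    dsimp only at this
    rw [sqDist_comm q, sqDist_comm (w n).2]
    linarith
  · have hmem : ((w n).1.1, (w n).2.2) ∈ S := by
      have h₁ := (hwS n).1
      have h₂ := (hwS n).2
      rw [hS, ← closedBall_prod_same] at h₁ h₂ ⊢
      exact ⟨h₁.1, h₂.2⟩
    have := hwmax n ((w n).1, (w n).1.1, (w n).2.2) ⟨(hwS n).1, hmem⟩
    dsimp only at this
    refine norm_smul_sub_le_of_doubled_max (t := (w n).1.2) (hGK (w n).2.2) n.cast_nonneg ?_
    simp only [Prod.mk.eta]
    linarith

lemma exists_momentum_of_isLocalMax_sub_sub (hH : IsConvexCoerciveHamiltonian H νl νu)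
    (hu : IsViscositySubsolution H ζ u) (hv : IsViscositySupersolution H ζ v)
    (hvK : ∀ s, LipschitzWith K fun y => v (y, s)) (hψ : ContDiff ℝ 1 ψ) (ht : 0 < t)
    (hζ : ContDiffAt ℝ 1 (pathExt ζ) t)
    (hmax : IsLocalMax (fun q => timeExt u q - timeExt v q - ψ q) (x, t)) :
    ∃ p, ‖p‖ ≤ 2 * K ∧ deriv (fun r => ψ (x, r)) t ≤
      (H (gradient (fun z => ψ (z, t)) x + p) x - H p x) * deriv (pathExt ζ) t := by
  obtain ⟨w, hw, hwn⟩ := exists_doubled_touching_sequence (continuous_timeExt u)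
    (continuous_timeExt v) hψ.continuous (fun s => hvK s.toNNReal) hmax
  have hψ' := contDiff_add_mul_sqDist hψ 1 (x, t)
  let p : ℕ → Space d := fun n => (2 * n : ℝ) • ((w n).1.1 - (w n).2.1)
  obtain ⟨q, hq, k, hk, hpq⟩ := (isCompact_closedBall (0 : Space d) (2 * K)).tendsto_subseq'
    (x := p) (hwn.mono fun n hn => mem_closedBall_zero_iff.2 hn.2.2).frequently
  refine ⟨q, mem_closedBall_zero_iff.1 hq, ?_⟩
  have hwk := hw.comp hk.tendsto_atTop
  have h₁ := hwk.fst_nhds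
  have h₂ := hwk.snd_nhds
  have hreg : ∀ᶠ r in 𝓝 t, 0 < r ∧ ContDiffAt ℝ 1 (pathExt ζ) r :=
    (eventually_gt_nhds ht).and (hζ.eventually (by simp))
  have hderiv := ((continuous_deriv_time hψ').tendsto (x, t)).comp h₁
  have hgrad := ((continuous_gradient_space hψ').tendsto (x, t)).comp h₁
  have hcont := continuousAt_deriv_of_contDiffAt hζ
  have hlim := (((hH.continuous_uncurry.tendsto _).comp
    ((hgrad.add hpq).prodMk_nhds h₁.fst_nhds)).mul (hcont.tendsto.comp h₁.snd_nhds)).sub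
    (((hH.continuous_uncurry.tendsto _).comp (hpq.prodMk_nhds h₂.fst_nhds)).mul
      (hcont.tendsto.comp h₂.snd_nhds))
  have hle := le_of_tendsto_of_tendsto hderiv hlim <| by
    filter_upwards [hk.tendsto_atTop.eventually hwn, h₁.snd_nhds.eventually hreg,
      h₂.snd_nhds.eventually hreg] with n hn ht hs
    exact deriv_le_of_isLocalMax_doubled hu hv hψ' ht.1 hs.1 ht.2 hs.2 _ hn.1 hn.2.1
  simp only [deriv_add_mul_sqDist hψ, gradient_add_mul_sqDist hψ, sub_self, mul_zero, smul_zero,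
    add_zero] at hle
  rwa [sub_mul]

end DoublingSolutions

section Barrier

variable {E : Type*} [NormedAddCommGroup E]

/-- The function `β e^{lt} (1 + |x|²) + η e^{kt}`. Subtracted from the difference of two functions
of linear growth it localizes their maximum: the first term rules out large `x`, the second one,
with `k` large, the final time. -/
noncomputable def barrier (l β k η : ℝ) (q : E × ℝ) : ℝ :=
  β * Real.exp (l * q.2) * (1 + ‖q.1‖ ^ 2) + η * Real.exp (k * q.2)

lemma continuous_barrier (l β k η : ℝ) : Continuous (barrier (E := E) l β k η) := by
  unfold barrier
  fun_prop

lemma deriv_barrier (l β k η : ℝ) (x : E) (t : ℝ) :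
    deriv (fun s => barrier l β k η (x, s)) t
      = β * l * Real.exp (l * t) * (1 + ‖x‖ ^ 2) + η * k * Real.exp (k * t) := by
  have hexp (l : ℝ) : HasDerivAt (fun s => Real.exp (l * s)) (Real.exp (l * t) * (l * 1)) t :=
    ((hasDerivAt_id t).const_mul l).exp
  refine (((((hexp l).const_mul β).mul_const (1 + ‖x‖ ^ 2)).add
    ((hexp k).const_mul η)).congr_deriv ?_).deriv
  ring

lemma exists_barrier_lt_and_le {C δ t₀ b : ℝ} (hδ : 0 < δ) (htb : t₀ < b) (x₀ : E) (l : ℝ) :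
    ∃ β > 0, ∃ k > 0, ∃ η > 0, barrier l β k η (x₀, t₀) < δ ∧
      ∀ x : E, C * (1 + ‖x‖) ≤ barrier l β k η (x, b) := by
  set β := δ / (4 * (Real.exp (l * t₀) * (1 + ‖x₀‖ ^ 2))) with hβ
  set B := β * Real.exp (l * b)
  set c := C / (2 * B)
  have hB : 0 < B := by positivity
  have hC : C = 2 * B * c := (mul_div_cancel₀ C (by positivity)).symm
  have hlarge : Tendsto (fun k => δ / 4 * Real.exp (k * (b - t₀))) atTop atTop :=
    (Real.tendsto_exp_atTop.comp (tendsto_id.atTop_mul_const (sub_pos.2 htb))).const_mul_atTop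
      (by positivity)
  obtain ⟨k, hkb, hk⟩ := ((hlarge.eventually_ge_atTop (C + B * c ^ 2)).and
    (eventually_gt_atTop 0)).exists
  refine ⟨β, by positivity, k, hk, δ / 4 * Real.exp (-(k * t₀)), by positivity, ?_, fun x => ?_⟩
  · have hβ' : β * Real.exp (l * t₀) * (1 + ‖x₀‖ ^ 2) = δ / 4 := by
      rw [hβ]
      field_simp
    rw [barrier, hβ', mul_assoc, ← Real.exp_add, neg_add_cancel, Real.exp_zero]
    linarith
  · have hsq : C * ‖x‖ ≤ B * ‖x‖ ^ 2 + B * c ^ 2 := by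
      linear_combination ‖x‖ * hC + mul_le_mul_of_nonneg_left (two_mul_le_add_sq ‖x‖ c) hB.le
    rw [barrier, mul_assoc (δ / 4), ← Real.exp_add,
      show -(k * t₀) + k * b = k * (b - t₀) by ring]
    linarith

lemma mul_one_add_norm_le_barrier {l β k η C a t : ℝ} {x : E} (hl : 0 ≤ l) (hβ : 0 < β)
    (hη : 0 ≤ η) (hC : 0 ≤ C) (hat : a ≤ t) (hx : 1 + 2 * C / (β * Real.exp (l * a)) ≤ ‖x‖) :
    C * (1 + ‖x‖) ≤ barrier l β k η (x, t) := by
  set B := β * Real.exp (l * a)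
  have hx1 : 1 ≤ ‖x‖ := (le_add_of_nonneg_right (by positivity)).trans hx
  have hxC : 2 * C ≤ ‖x‖ * B := (div_le_iff₀ (by positivity)).1 (by linarith)
  have hexp : B ≤ β * Real.exp (l * t) :=
    mul_le_mul_of_nonneg_left (Real.exp_le_exp.2 (mul_le_mul_of_nonneg_left hat hl)) hβ.le
  have hB : 0 < B := by positivity
  calc C * (1 + ‖x‖) ≤ 2 * C * ‖x‖ := by linarith [mul_le_mul_of_nonneg_left hx1 hC]
    _ ≤ ‖x‖ * B * ‖x‖ := by gcongr
    _ ≤ B * (1 + ‖x‖ ^ 2) := by linarith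
    _ ≤ β * Real.exp (l * t) * (1 + ‖x‖ ^ 2) := by gcongr
    _ ≤ barrier l β k η (x, t) := le_add_of_nonneg_right (by positivity)

lemma exists_isLocalMax_sub_barrier [ProperSpace E] {U : E × ℝ → ℝ} (hU : Continuous U)
    {a b C l : ℝ} (hl : 0 ≤ l) (hgrowth : ∀ x, ∀ t ∈ Set.Icc a b, U (x, t) ≤ C * (1 + ‖x‖))
    (ha : ∀ x, U (x, a) ≤ 0) {x₀ : E} {t₀ : ℝ} (hat : a ≤ t₀) (htb : t₀ < b)
    (hpos : 0 < U (x₀, t₀)) :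
    ∃ β > 0, ∃ k > 0, ∃ η > 0, ∃ x, ∃ t ∈ Set.Ioo a b,
      IsLocalMax (fun q => U q - barrier l β k η q) (x, t) ∧
      β * Real.exp (l * t) * (1 + ‖x‖ ^ 2) ≤ C * (1 + ‖x‖) := by
  obtain ⟨β, hβ, k, hk, η, hη, hlt, hb⟩ := exists_barrier_lt_and_le (C := C) hpos htb x₀ l
  have hC : 0 ≤ C := (pos_of_mul_pos_left (hpos.trans_le (hgrowth x₀ t₀ ⟨hat, htb.le⟩))
    (by positivity)).le
  set R := 1 + 2 * C / (β * Real.exp (l * a))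
  obtain ⟨⟨x, t⟩, ⟨-, ht⟩, hmax⟩ := ContinuousOn.exists_isMaxOn'
    (hU.sub (continuous_barrier l β k η)).continuousOn (isClosed_univ.prod isClosed_Icc)
    (x₀ := (x₀, t₀)) ⟨trivial, hat, htb.le⟩ (by
      rw [eventually_inf_principal]
      filter_upwards [((isCompact_closedBall (0 : E) R).prod
        (isCompact_Icc (a := a) (b := b))).compl_mem_cocompact] with q hq hqS
      have hqR : R ≤ ‖q.1‖ := (not_le.1 fun hle => hq
        ⟨mem_closedBall_zero_iff.2 hle, hqS.2⟩).le
      exact (sub_nonpos.2 ((hgrowth q.1 q.2 hqS.2).trans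
        (mul_one_add_norm_le_barrier hl hβ hη.le hC hqS.2.1 hqR))).trans (sub_pos.2 hlt).le)
  have hxt : barrier l β k η (x, t) < U (x, t) :=
    sub_pos.1 ((sub_pos.2 hlt).trans_le (hmax ⟨trivial, hat, htb.le⟩))
  have hηt : 0 < η * Real.exp (k * t) := by positivity
  have hβt : 0 < β * Real.exp (l * t) * (1 + ‖x‖ ^ 2) := by positivity
  have htab : t ∈ Set.Ioo a b := by
    refine ⟨ht.1.lt_of_ne ?_, ht.2.lt_of_ne ?_⟩
    · rintro rfl
      exact (add_pos hβt hηt).not_ge (hxt.le.trans (ha x))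
    · rintro rfl
      exact (hxt.trans_le (hgrowth x t ht)).not_ge (hb x)
  refine ⟨β, hβ, k, hk, η, hη, x, t, htab, ?_, ?_⟩
  · filter_upwards [prod_mem_nhds univ_mem (Icc_mem_nhds htab.1 htab.2)] with q hq using hmax hq
  · exact (le_add_of_nonneg_right hηt.le).trans (hxt.le.trans (hgrowth x t ht))

variable [InnerProductSpace ℝ E]

lemma contDiff_barrier (l β k η : ℝ) : ContDiff ℝ 1 (barrier (E := E) l β k η) := by
  have hexp (l : ℝ) : ContDiff ℝ 1 fun q : E × ℝ => Real.exp (l * q.2) :=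
    (contDiff_const.mul contDiff_snd).exp
  exact ((contDiff_const.mul (hexp l)).mul (contDiff_const.add (contDiff_fst.norm_sq ℝ))).add
    (contDiff_const.mul (hexp k))

lemma gradient_barrier [CompleteSpace E] (l β k η : ℝ) (x : E) (t : ℝ) :
    gradient (fun y => barrier l β k η (y, t)) x = (2 * (β * Real.exp (l * t))) • x := by
  refine HasGradientAt.gradient (hasGradientAt_iff_hasFDerivAt.2
    (((((hasStrictFDerivAt_norm_sq x).hasFDerivAt.const_add 1).const_mul
      (β * Real.exp (l * t))).add_const (η * Real.exp (k * t))).congr_fderiv ?_))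
  ext y
  simp
  ring

lemma norm_gradient_barrier_le [CompleteSpace E] {l β k η t C : ℝ} {x : E} (hβ : 0 < β)
    (h : β * Real.exp (l * t) * (1 + ‖x‖ ^ 2) ≤ C * (1 + ‖x‖)) :
    ‖gradient (fun y => barrier l β k η (y, t)) x‖ ≤ 4 * C := by
  have hB : 0 < β * Real.exp (l * t) := by positivity
  have hx : 0 < 1 + ‖x‖ := by positivity
  have hle : β * Real.exp (l * t) * (1 + ‖x‖) ≤ 2 * C := by
    refine le_of_mul_le_mul_right ?_ hx
    nlinarith [mul_nonneg hB.le (sq_nonneg (1 - ‖x‖))]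
  rw [gradient_barrier, norm_smul, Real.norm_of_nonneg (by positivity)]
  linarith

end Barrier

section Comparison

variable {d : ℕ} {H : Space d → Space d → ℝ} {νl νu : ℝ → ℝ} {ζ : C(ℝ≥0, ℝ)}
  {u v : C(Space d × ℝ≥0, ℝ)} {K : ℝ≥0}

lemma IsConvexCoerciveHamiltonian.exists_lipschitzOnWith_ball
    (hH : IsConvexCoerciveHamiltonian H νl νu) (R : ℝ) :
    ∃ L : ℝ≥0, ∀ x, LipschitzOnWith L (fun p => H p x) (Metric.ball 0 R) := by
  refine ⟨(2 * ((νl 0)⁻ + |νu (R + 1)|) / 1).toNNReal, fun x => ?_⟩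
  have hbound : ∀ q, dist q 0 < R + 1 → |H q x| ≤ (νl 0)⁻ + |νu (R + 1)| := fun q hq => by
    rw [dist_zero_right] at hq
    have hlow := hH.neg_negPart_le q x
    have hupp := (hH.le_upper q x).trans
      (hH.upper_mono (norm_nonneg q) ((norm_nonneg q).trans hq.le) hq.le)
    exact abs_le.2 ⟨by linarith [abs_nonneg (νu (R + 1))],
      by linarith [le_abs_self (νu (R + 1)), negPart_nonneg (νl 0)]⟩
  simpa only [add_sub_cancel_right] using ((hH.convex x).subset (Set.subset_univ _)
    (convex_ball 0 (R + 1))).lipschitzOnWith_of_abs_le one_pos hbound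

lemma exists_bound_deriv_of_contDiffOn_Icc {f : ℝ → ℝ} {a b : ℝ} (hab : a < b)
    (hf : ContDiffOn ℝ 1 f (Set.Icc a b)) : ∃ C, ∀ t ∈ Set.Ioo a b, |deriv f t| ≤ C := by
  obtain ⟨C, hC⟩ := isCompact_Icc.exists_bound_of_continuousOn
    (hf.continuousOn_derivWithin (uniqueDiffOn_Icc hab) le_rfl)
  refine ⟨C, fun t ht => ?_⟩
  simpa only [derivWithin_of_mem_nhds (Icc_mem_nhds ht.1 ht.2), Real.norm_eq_abs]
    using hC t (Set.Ioo_subset_Icc_self ht)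

lemma comparison_on_smooth_interval (hH : IsConvexCoerciveHamiltonian H νl νu)
    (hu : IsViscositySubsolution H ζ u) (hv : IsViscositySupersolution H ζ v)
    (hvK : ∀ t, LipschitzWith K fun x => v (x, t)) {a b : ℝ} (ha : 0 ≤ a)
    (hζ : ContDiffOn ℝ 1 (pathExt ζ) (Set.Icc a b)) {C : ℝ}
    (hgrowth : ∀ x, ∀ t ∈ Set.Icc a b, timeExt u (x, t) - timeExt v (x, t) ≤ C * (1 + ‖x‖))
    (hle : ∀ x, timeExt u (x, a) ≤ timeExt v (x, a)) (x₀ : Space d) {t₀ : ℝ} (hat : a ≤ t₀)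
    (htb : t₀ < b) : timeExt u (x₀, t₀) ≤ timeExt v (x₀, t₀) := by
  by_contra! hlt
  obtain ⟨Λ, hΛ⟩ := exists_bound_deriv_of_contDiffOn_Icc (hat.trans_lt htb) hζ
  obtain ⟨L, hL⟩ := hH.exists_lipschitzOnWith_ball (4 * C + 2 * K + 1)
  have hl : 0 ≤ |Λ| * L := by positivity
  obtain ⟨β, hβ, k, hk, η, hη, x, t, ht, hmax, hxt⟩ := exists_isLocalMax_sub_barrier
    ((continuous_timeExt u).sub (continuous_timeExt v)) hl hgrowth
    (fun x => sub_nonpos.2 (hle x)) hat htb (sub_pos.2 hlt)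
  obtain ⟨p, hp, hineq⟩ := exists_momentum_of_isLocalMax_sub_sub hH hu hv hvK
    (contDiff_barrier _ β k η) (ha.trans_lt ht.1)
    (hζ.contDiffAt (Icc_mem_nhds ht.1 ht.2)) hmax
  set g := gradient (fun y => barrier (|Λ| * L) β k η (y, t)) x with hg
  have hg4 : ‖g‖ ≤ 4 * C := norm_gradient_barrier_le hβ hxt
  have hLip : |H (g + p) x - H p x| ≤ L * ‖g‖ := by
    rw [← Real.dist_eq, ← add_sub_cancel_right g p, ← dist_eq_norm, add_sub_cancel_right]
    exact (hL x).dist_le_mul (g + p) (mem_ball_zero_iff.2 (by linarith [norm_add_le g p]))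
      p (mem_ball_zero_iff.2 (by linarith [norm_nonneg g]))
  have hpos : 0 < η * k * Real.exp (k * t) := by positivity
  have hupper : deriv (fun s => barrier (|Λ| * L) β k η (x, s)) t ≤ L * ‖g‖ * |Λ| :=
    hineq.trans <| (le_abs_self _).trans <| by
      rw [abs_mul]
      exact mul_le_mul hLip ((hΛ t ht).trans (le_abs_self Λ)) (abs_nonneg _) (by positivity)
  rw [deriv_barrier, hg, gradient_barrier, norm_smul, Real.norm_of_nonneg (by positivity)]
    at hupper
  have hsq : 0 ≤ β * (|Λ| * L) * Real.exp (|Λ| * L * t) * (1 - ‖x‖) ^ 2 := by positivity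
  linarith

end Comparison

section TimeReversal

variable {d : ℕ} {H : Space d → Space d → ℝ} {ζ : C(ℝ≥0, ℝ)} {u : C(Space d × ℝ≥0, ℝ)}

lemma gradient_fun_neg (f : Space d → ℝ) (x : Space d) :
    gradient (fun y => -f y) x = -gradient f x := by
  simp only [gradient]
  rw [fderiv_fun_neg, map_neg]

lemma pathExt_neg (ζ : C(ℝ≥0, ℝ)) : pathExt (-ζ) = fun t => -pathExt ζ t := rfl

lemma contDiffAt_pathExt_of_neg {t : ℝ} (hζ : ContDiffAt ℝ 1 (pathExt (-ζ)) t) :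
    ContDiffAt ℝ 1 (pathExt ζ) t := by
  simpa only [pathExt_neg, neg_neg] using hζ.neg

lemma IsPiecewiseC1Path.neg (hζ : IsPiecewiseC1Path ζ) : IsPiecewiseC1Path (-ζ) := by
  intro t ht
  obtain ⟨ε, hε, hright, hleft⟩ := hζ t ht
  exact ⟨ε, hε, hright.neg, fun h => (hleft h).neg⟩

lemma IsViscositySubsolution.momentumFlip (hu : IsViscositySubsolution H ζ u) :
    IsViscositySupersolution (momentumFlip H) (-ζ) (-u) := by
  intro φ hφ x t ht hζ hmin
  have hsub := hu (fun q => -φ q) hφ.neg x t ht (contDiffAt_pathExt_of_neg hζ) <|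
    hmin.neg.congr <| .of_forall fun q => by
      simp only [ContinuousMap.neg_apply]
      ring
  rw [gradient_fun_neg, deriv.fun_neg] at hsub
  rw [pathExt_neg, deriv.fun_neg, _root_.momentumFlip]
  linarith

lemma IsViscositySupersolution.momentumFlip (hu : IsViscositySupersolution H ζ u) :
    IsViscositySubsolution (momentumFlip H) (-ζ) (-u) := by
  intro φ hφ x t ht hζ hmax
  have hsup := hu (fun q => -φ q) hφ.neg x t ht (contDiffAt_pathExt_of_neg hζ) <|
    hmax.neg.congr <| .of_forall fun q => by
      simp only [ContinuousMap.neg_apply]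
      ring
  rw [gradient_fun_neg, deriv.fun_neg] at hsup
  rw [pathExt_neg, deriv.fun_neg, _root_.momentumFlip]
  linarith

end TimeReversal

section GlobalComparison

variable {d : ℕ} {H : Space d → Space d → ℝ} {νl νu : ℝ → ℝ} {ζ : C(ℝ≥0, ℝ)}
  {u v : C(Space d × ℝ≥0, ℝ)} {K : ℝ≥0}

/-- At most linear growth in space, locally uniformly in time: the growth condition in
`IsViscositySolution`. -/
def HasLinearGrowth (u : C(Space d × ℝ≥0, ℝ)) : Prop :=
  ∀ T : ℝ≥0, ∃ C : ℝ, ∀ x, ∀ t ≤ T, |u (x, t)| ≤ C * (1 + ‖x‖)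

lemma HasLinearGrowth.neg (hu : HasLinearGrowth u) : HasLinearGrowth (-u) := by
  simpa only [HasLinearGrowth, ContinuousMap.neg_apply, abs_neg] using hu

lemma HasLinearGrowth.exists_sub_le (hu : HasLinearGrowth u) (hv : HasLinearGrowth v) (b : ℝ) :
    ∃ C, ∀ x, ∀ t ≤ b, timeExt u (x, t) - timeExt v (x, t) ≤ C * (1 + ‖x‖) := by
  obtain ⟨C₁, h₁⟩ := hu b.toNNReal
  obtain ⟨C₂, h₂⟩ := hv b.toNNReal
  refine ⟨C₁ + C₂, fun x t ht => ?_⟩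
  have hu := abs_le.1 (h₁ x _ (Real.toNNReal_mono ht))
  have hv := abs_le.1 (h₂ x _ (Real.toNNReal_mono ht))
  simp only [timeExt]
  linarith

lemma comparison_of_lipschitz_supersolution (hH : IsConvexCoerciveHamiltonian H νl νu)
    (hζ : IsPiecewiseC1Path ζ) (hu : IsViscositySubsolution H ζ u)
    (hv : IsViscositySupersolution H ζ v) (hug : HasLinearGrowth u) (hvg : HasLinearGrowth v)
    (hvK : ∀ t, LipschitzWith K fun x => v (x, t))
    (hle : ∀ x, u (x, 0) ≤ v (x, 0)) (x : Space d) (t : ℝ≥0) : u (x, t) ≤ v (x, t) := by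
  set s : Set ℝ := {r | ∀ x, timeExt u (x, r) ≤ timeExt v (x, r)} with hs
  have hclosed : IsClosed s := by
    rw [hs, Set.ofPred_forall]
    exact isClosed_iInter fun x => isClosed_le ((continuous_timeExt u).comp (.prodMk_right x))
      ((continuous_timeExt v).comp (.prodMk_right x))
  have h0 : (0 : ℝ) ∈ s := fun x => by simpa only [timeExt, Real.toNNReal_zero] using hle x
  have hsub : Set.Icc (0 : ℝ) t ⊆ s := by
    refine (hclosed.inter isClosed_Icc).Icc_subset_of_forall_exists_gt h0 ?_
    rintro r ⟨hr, hr0, -⟩ y (hy : r < y)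
    obtain ⟨ε, hε, hC1, -⟩ := hζ r hr0
    obtain ⟨C, hC⟩ := hug.exists_sub_le hvg (r + ε)
    have hlt : r < min y (r + ε / 2) := lt_min hy (by linarith)
    exact ⟨min y (r + ε / 2), fun z => comparison_on_smooth_interval hH hu hv hvK hr0 hC1
      (fun x t ht => hC x t ht.2) hr z hlt.le ((min_le_right _ _).trans_lt (by linarith)),
      hlt, min_le_left _ _⟩
  have ht : timeExt u (x, (t : ℝ)) ≤ timeExt v (x, (t : ℝ)) := hsub ⟨t.2, le_rfl⟩ x
  simpa only [timeExt, Real.toNNReal_coe] using ht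

lemma comparison_of_lipschitz_subsolution (hH : IsConvexCoerciveHamiltonian H νl νu)
    (hζ : IsPiecewiseC1Path ζ) (hu : IsViscositySubsolution H ζ u)
    (hv : IsViscositySupersolution H ζ v) (hug : HasLinearGrowth u) (hvg : HasLinearGrowth v)
    (huK : ∀ t, LipschitzWith K fun x => u (x, t))
    (hle : ∀ x, u (x, 0) ≤ v (x, 0)) (x : Space d) (t : ℝ≥0) : u (x, t) ≤ v (x, t) :=
  neg_le_neg_iff.1 <| comparison_of_lipschitz_supersolution hH.momentumFlip hζ.neg hv.momentumFlip
    hu.momentumFlip hvg.neg hug.neg (fun t => (huK t).neg) (fun x => neg_le_neg (hle x)) x t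

end GlobalComparison

section Stability

lemma exists_tendsto_maximizers {X : Type*} [TopologicalSpace X] {f : X → ℝ} {F : ℕ → X → ℝ}
    (hF : ∀ n, Continuous (F n)) (hFf : TendstoUniformly F f atTop) {S : Set X}
    (hS : IsCompact S) {z₀ : X} (hz₀ : z₀ ∈ S) (hmax : ∀ z ∈ S, f z₀ ≤ f z → z = z₀) :
    ∃ w : ℕ → X, Tendsto w atTop (𝓝 z₀) ∧ ∀ n, ∀ q ∈ S, F n q ≤ F n (w n) := by
  have hex : ∀ n, ∃ w ∈ S, ∀ q ∈ S, F n q ≤ F n w := fun n =>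
    hS.exists_isMaxOn ⟨z₀, hz₀⟩ (hF n).continuousOn
  choose w hwS hw using hex
  refine ⟨w, hS.tendsto_nhds_of_unique_mapClusterPt (Eventually.of_forall hwS) ?_, hw⟩
  refine fun a ha hwa => hmax a ha (le_of_mapClusterPt
    (hFf.continuous (Eventually.of_forall hF).frequently) hwa fun b hb => ?_)
  filter_upwards [Metric.tendstoUniformly_iff.1 hFf _ (half_pos (sub_pos.2 hb))] with n hn
  have hz := (abs_lt.1 (hn z₀)).2
  have hwn := (abs_lt.1 (hn (w n))).1
  linarith [hw n z₀ hz₀]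

variable {d : ℕ} {H : Space d → Space d → ℝ} {ζ : C(ℝ≥0, ℝ)}
  {u : C(Space d × ℝ≥0, ℝ)} {w : ℕ → C(Space d × ℝ≥0, ℝ)}

lemma exists_touching_sequence {φ : Space d × ℝ → ℝ} (hφ : Continuous φ)
    (hw : TendstoUniformly (fun n => w n) u atTop) {z₀ : Space d × ℝ}
    (hmax : IsLocalMax (fun q => timeExt u q - φ q) z₀) :
    ∃ z : ℕ → Space d × ℝ, Tendsto z atTop (𝓝 z₀) ∧
      ∀ᶠ n in atTop, IsLocalMax (fun q => timeExt (w n) q - (φ q + 1 * sqDist q z₀)) (z n) := by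
  obtain ⟨r, hr, hball⟩ := Metric.eventually_nhds_iff_ball.1 hmax
  have hψ : Continuous fun q => φ q + 1 * sqDist q z₀ :=
    hφ.add (continuous_const.mul (continuous_sqDist.comp (.prodMk_left z₀)))
  have hunif : TendstoUniformly (fun n q => timeExt (w n) q - (φ q + 1 * sqDist q z₀))
      (fun q => timeExt u q - (φ q + 1 * sqDist q z₀)) atTop := by
    refine Metric.tendstoUniformly_iff.2 fun ε hε => ?_
    filter_upwards [Metric.tendstoUniformly_iff.1 hw ε hε] with n hn q
    rw [dist_sub_right]
    exact hn (q.1, q.2.toNNReal)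
  have hnhds : Metric.closedBall z₀ (r / 2) ∈ 𝓝 z₀ := Metric.closedBall_mem_nhds _ (half_pos hr)
  obtain ⟨z, hz, hzmax⟩ := exists_tendsto_maximizers
    (fun n => (continuous_timeExt (w n)).sub hψ) hunif (isCompact_closedBall z₀ (r / 2))
    (mem_of_mem_nhds hnhds) fun q hq hle => by
      have hle' := hball q (Metric.closedBall_subset_ball (half_lt_self hr) hq)
      rw [sqDist_self] at hle
      exact sqDist_eq_zero.1 (le_antisymm (by linarith) (sqDist_nonneg q z₀))
  refine ⟨z, hz, ?_⟩
  filter_upwards [hz.eventually (eventually_mem_nhds_iff.2 hnhds)] with n hn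
  filter_upwards [hn] with q hq using hzmax n q hq

lemma isViscositySubsolution_of_tendstoUniformly
    (hH : Continuous fun q : Space d × Space d => H q.1 q.2)
    (hw : ∀ n, IsViscositySubsolution H ζ (w n))
    (hwu : TendstoUniformly (fun n => w n) u atTop) : IsViscositySubsolution H ζ u := by
  intro φ hφ x t ht hζ hmax
  obtain ⟨z, hz, hzmax⟩ := exists_touching_sequence hφ.continuous hwu hmax
  have hψ := contDiff_add_mul_sqDist hφ 1 (x, t)
  have hlim := ((hH.tendsto _).comp ((((continuous_gradient_space hψ).tendsto (x, t)).comp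
    hz).prodMk_nhds hz.fst_nhds)).mul
    ((continuousAt_deriv_of_contDiffAt hζ).tendsto.comp hz.snd_nhds)
  have hle := le_of_tendsto_of_tendsto (((continuous_deriv_time hψ).tendsto (x, t)).comp hz) hlim <|
    by
      filter_upwards [hzmax, hz.snd_nhds.eventually (eventually_gt_nhds ht),
        hz.snd_nhds.eventually (hζ.eventually (by simp))] with n hn ht hζ
      exact hw n _ hψ _ _ ht hζ hn
  simpa only [deriv_add_mul_sqDist hφ, gradient_add_mul_sqDist hφ, sub_self, mul_zero, smul_zero,
    add_zero] using hle

end Stability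

section LipschitzApproximation

variable {E : Type*} [NormedAddCommGroup E] {u : E → ℝ} {ε L ρ : ℝ}

lemma sub_le_nat_mul_of_dist_le [NormedSpace ℝ E] (hρ : 0 ≤ ρ)
    (h : ∀ x y, dist x y ≤ ρ → u x - u y ≤ ε) :
    ∀ (n : ℕ) (x y : E), dist x y ≤ n * ρ → u x - u y ≤ n * ε
  | 0, x, y, hxy => by
    have : x = y := dist_le_zero.1 (by simpa using hxy)
    simp [this]
  | n + 1, x, y, hxy => by
    obtain ⟨z, hxz, hzy⟩ := exists_dist_le_le hρ (by positivity : 0 ≤ n * ρ)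
      (hxy.trans_eq (by push_cast; ring))
    have hone := h x z hxz
    have hrest := sub_le_nat_mul_of_dist_le hρ h n z y hzy
    push_cast
    linarith

lemma exists_sub_le_add_mul_dist [NormedSpace ℝ E] (hu : UniformContinuous u) (hε : 0 < ε) :
    ∃ L ≥ 0, ∀ x y, u x - u y ≤ ε + L * dist x y := by
  obtain ⟨ρ, hρ, h⟩ := Metric.uniformContinuous_iff_le.1 hu ε hε
  refine ⟨ε / ρ, by positivity, fun x y => ?_⟩
  have hρ' : ∀ x y, dist x y ≤ ρ → u x - u y ≤ ε := fun x y hxy =>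
    (le_abs_self _).trans (h hxy)
  calc u x - u y ≤ ⌈dist x y / ρ⌉₊ * ε := sub_le_nat_mul_of_dist_le hρ.le hρ' _ x y <|
        (div_le_iff₀ hρ).1 (Nat.le_ceil _)
    _ ≤ (dist x y / ρ + 1) * ε := by gcongr; exact (Nat.ceil_lt_add_one (by positivity)).le
    _ = ε + ε / ρ * dist x y := by ring

/-- The inf-convolution of `u` with the cone `L‖·‖`: the largest `L`-Lipschitz function below `u`,
when there is one. -/
noncomputable def lipschitzEnvelope (L : ℝ) (u : E → ℝ) (x : E) : ℝ := ⨅ y, (u y + L * dist x y)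

lemma bddBelow_range_add_mul_dist (h : ∀ x y, u x - u y ≤ ε + L * dist x y) (x : E) :
    BddBelow (Set.range fun y => u y + L * dist x y) :=
  ⟨u x - ε, Set.forall_mem_range.2 fun y => by linarith [h x y]⟩

lemma lipschitzWith_lipschitzEnvelope (hL : 0 ≤ L) (h : ∀ x y, u x - u y ≤ ε + L * dist x y) :
    LipschitzWith L.toNNReal (lipschitzEnvelope L u) := by
  refine LipschitzWith.of_le_add_mul _ fun x y => ?_
  rw [← sub_le_iff_le_add, Real.coe_toNNReal L hL]
  refine le_ciInf fun z => ?_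
  calc lipschitzEnvelope L u x - L * dist x y ≤ u z + L * dist x z - L * dist x y :=
        sub_le_sub_right (ciInf_le (bddBelow_range_add_mul_dist h x) z) _
    _ ≤ u z + L * dist y z := by
        linarith [mul_le_mul_of_nonneg_left (dist_triangle x y z) hL]

lemma abs_sub_lipschitzEnvelope_le (h : ∀ x y, u x - u y ≤ ε + L * dist x y) (x : E) :
    |u x - lipschitzEnvelope L u x| ≤ ε := by
  have hle : lipschitzEnvelope L u x ≤ u x :=
    (ciInf_le (bddBelow_range_add_mul_dist h x) x).trans_eq (by simp)
  have hge : u x - ε ≤ lipschitzEnvelope L u x := le_ciInf fun y => by linarith [h x y]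
  rw [abs_of_nonneg (sub_nonneg.2 hle)]
  linarith

lemma exists_lipschitzWith_abs_sub_le [NormedSpace ℝ E] (hu : UniformContinuous u) (hε : 0 < ε) :
    ∃ (L : ℝ≥0) (v : E → ℝ), LipschitzWith L v ∧ ∀ x, |u x - v x| ≤ ε := by
  obtain ⟨L, hL, h⟩ := exists_sub_le_add_mul_dist hu hε
  exact ⟨L.toNNReal, lipschitzEnvelope L u, lipschitzWith_lipschitzEnvelope hL h,
    abs_sub_lipschitzEnvelope_le h⟩

end LipschitzApproximation

section FlowEstimates

variable {E : Type*} [NormedAddCommGroup E] [InnerProductSpace ℝ E] {H : E → E → ℝ}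
  {m c c' ε M : ℝ} {u v : E → ℝ} {ζ : C(ℝ≥0, ℝ)} {s t : ℝ≥0}

namespace CostDominated

lemma abs_pathFlow_sub_pathFlow_le (hm0 : 0 ≤ m) (hm : ∀ p x, -m ≤ H p x)
    (hu : CostDominated H c u) (hv : CostDominated H c' v) (h : ∀ x, |u x - v x| ≤ ε)
    (ζ : C(ℝ≥0, ℝ)) (t : ℝ≥0) (x : E) : |pathFlow H ζ u t x - pathFlow H ζ v t x| ≤ ε := by
  have hu' := hu.weaken (le_max_left c c')
  have hv' := hv.weaken (le_max_right c c')
  have huv := hu'.pathFlow_le_add hm0 hm hv' (D := ε)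
    (fun x => by linarith [(abs_sub_le_iff.1 (h x)).1]) ζ t x
  have hvu := hv'.pathFlow_le_add hm0 hm hu' (D := ε)
    (fun x => by linarith [(abs_sub_le_iff.1 (h x)).2]) ζ t x
  rw [abs_sub_le_iff]
  constructor <;> linarith

lemma abs_pathFlow_sub_le_of_uIcc (hm0 : 0 ≤ m) (hm : ∀ p x, -m ≤ H p x)
    (hu : CostDominated H c u) (hM : ∀ r ∈ Set.uIcc s t, |ζ r - ζ s| ≤ M) (x : E) :
    |pathFlow H ζ u t x - pathFlow H ζ u s x| ≤ (c + 2 * m) * (2 * M) := by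
  rcases le_total s t with hst | hts
  · refine hu.abs_pathFlow_sub_le hm0 hm hst (fun r hsr hrt => ?_) x
    have hr := hM r (Set.Icc_subset_uIcc ⟨hsr, hrt⟩)
    linarith [abs_nonneg (ζ r - ζ s)]
  · rw [abs_sub_comm]
    refine hu.abs_pathFlow_sub_le hm0 hm hts (fun r htr hrs => ?_) x
    have hr := hM r (Set.Icc_subset_uIcc' ⟨htr, hrs⟩)
    have ht := hM t Set.right_mem_uIcc
    rw [abs_sub_comm] at ht
    linarith [abs_sub_le (ζ r) (ζ s) (ζ t)]

lemma continuous_pathFlow_apply (hm0 : 0 ≤ m) (hm : ∀ p x, -m ≤ H p x)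
    (hu : CostDominated H c u) (ζ : C(ℝ≥0, ℝ)) (x : E) :
    Continuous fun t => pathFlow H ζ u t x := by
  refine continuous_iff_continuousAt.2 fun s => Metric.tendsto_nhds.2 fun ε hε => ?_
  obtain ⟨ω, hω, hωε⟩ := exists_pos_mul_lt hε ((c + 2 * m) * 2)
  have hnear : ∀ᶠ r in 𝓝 s, |ζ r - ζ s| < ω := Metric.tendsto_nhds.1 (ζ.continuous.tendsto s) ω hω
  have huIcc : ∀ᶠ t in 𝓝 s, ∀ r ∈ Set.uIcc s t, |ζ r - ζ s| < ω :=
    (tendsto_const_nhds.uIcc tendsto_id).eventually hnear.smallSets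
  filter_upwards [huIcc] with t ht
  exact (hu.abs_pathFlow_sub_le_of_uIcc hm0 hm (fun r hr => (ht r hr).le) x).trans_lt
    (by linarith)

lemma exists_abs_pathFlow_sub_le (hm0 : 0 ≤ m) (hm : ∀ p x, -m ≤ H p x)
    (hu : CostDominated H c u) (ζ : C(ℝ≥0, ℝ)) (T : ℝ≥0) :
    ∃ B, ∀ t ≤ T, ∀ x, |pathFlow H ζ u t x - u x| ≤ B := by
  obtain ⟨M, hM⟩ := isCompact_Icc.exists_bound_of_continuousOn
    (s := Set.Icc 0 T) (ζ.continuous.sub continuous_const).continuousOn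
  refine ⟨(c + 2 * m) * M, fun t ht x => ?_⟩
  have h := hu.abs_pathFlow_sub_le hm0 hm (zero_le (a := t))
    (fun r _ hr => hM r ⟨zero_le, hr.trans ht⟩) x
  rwa [pathFlow_zero] at h

end CostDominated

/-- The flow started from data which are merely approximated, uniformly, by cost-dominated functions
`v`: the supremum of the lower bounds `pathFlow H ζ v - ε` coming from `|u₀ - v| ≤ ε`. -/
noncomputable def extendedFlow (H : E → E → ℝ) (ζ : C(ℝ≥0, ℝ)) (u₀ : E → ℝ) (t : ℝ≥0) (x : E) :
    ℝ :=
  sSup {a | ∃ ε c v, CostDominated H c v ∧ (∀ y, |u₀ y - v y| ≤ ε) ∧ a = pathFlow H ζ v t x - ε}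

variable {u₀ : E → ℝ}

lemma abs_extendedFlow_sub_pathFlow_le (hm0 : 0 ≤ m) (hm : ∀ p x, -m ≤ H p x)
    (hv : CostDominated H c v) (h : ∀ x, |u₀ x - v x| ≤ ε) (t : ℝ≥0) (x : E) :
    |extendedFlow H ζ u₀ t x - pathFlow H ζ v t x| ≤ ε := by
  set A := {a | ∃ ε c v, CostDominated H c v ∧ (∀ y, |u₀ y - v y| ≤ ε) ∧
    a = pathFlow H ζ v t x - ε}
  have hmem : pathFlow H ζ v t x - ε ∈ A := ⟨ε, c, v, hv, h, rfl⟩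
  have hupper : pathFlow H ζ v t x + ε ∈ upperBounds A := by
    rintro _ ⟨ε', c', v', hv', h', rfl⟩
    have hdist : ∀ y, |v' y - v y| ≤ ε' + ε := fun y =>
      (abs_sub_le _ (u₀ y) _).trans (add_le_add (abs_sub_comm (u₀ y) _ ▸ h' y) (h y))
    linarith [(abs_sub_le_iff.1 (hv'.abs_pathFlow_sub_pathFlow_le hm0 hm hv hdist ζ t x)).1]
  rw [abs_sub_le_iff, sub_le_iff_le_add', sub_le_comm]
  exact ⟨csSup_le ⟨_, hmem⟩ hupper, le_csSup ⟨_, hupper⟩ hmem⟩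

lemma CostDominated.extendedFlow_eq (hm0 : 0 ≤ m) (hm : ∀ p x, -m ≤ H p x)
    (hu : CostDominated H c u₀) (t : ℝ≥0) (x : E) :
    extendedFlow H ζ u₀ t x = pathFlow H ζ u₀ t x := by
  have h := abs_extendedFlow_sub_pathFlow_le (ζ := ζ) (ε := 0) (u₀ := u₀) hm0 hm hu (by simp) t x
  rwa [abs_nonpos_iff, sub_eq_zero] at h

end FlowEstimates

section SolutionsWithLipschitzData

variable {d : ℕ} {H : Space d → Space d → ℝ} {νl νu : ℝ → ℝ} {K : ℝ≥0} {v : Space d → ℝ}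
  {ζ : C(ℝ≥0, ℝ)} {u w : C(Space d × ℝ≥0, ℝ)}

lemma HasLinearGrowth.of_abs_sub_le (hw : HasLinearGrowth w) {B : ℝ} (h : ∀ q, |u q - w q| ≤ B) :
    HasLinearGrowth u := by
  intro T
  obtain ⟨C, hC⟩ := hw T
  refine ⟨B + C, fun x t ht => ?_⟩
  have hB : 0 ≤ B := (abs_nonneg _).trans (h (x, t))
  calc |u (x, t)| ≤ |u (x, t) - w (x, t)| + |w (x, t)| := by
        simpa using abs_add_le (u (x, t) - w (x, t)) (w (x, t))
    _ ≤ B * (1 + ‖x‖) + C * (1 + ‖x‖) :=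
        add_le_add ((h _).trans (le_mul_of_one_le_right hB (by simp))) (hC x t ht)
    _ = (B + C) * (1 + ‖x‖) := by ring

lemma lipschitzWith_pathFlow (hH : IsConvexCoerciveHamiltonian H νl νu)
    (hv : CostDominated H (νl K) v) (ζ : C(ℝ≥0, ℝ)) (t : ℝ≥0) :
    LipschitzWith K (pathFlow H ζ v t) :=
  hH.lipschitz_of_costDominated (hv.pathFlow (negPart_nonneg _) hH.neg_negPart_le ζ t)

/-- `pathFlow H ζ v` as a continuous function on `ℝ^d × [0, ∞)`. -/
noncomputable def pathFlowMap (hH : IsConvexCoerciveHamiltonian H νl νu)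
    (hv : CostDominated H (νl K) v) (ζ : C(ℝ≥0, ℝ)) : C(Space d × ℝ≥0, ℝ) where
  toFun q := pathFlow H ζ v q.2 q.1
  continuous_toFun := continuous_prod_of_continuous_lipschitzWith _ K
    (hv.continuous_pathFlow_apply (negPart_nonneg _) hH.neg_negPart_le ζ)
    (lipschitzWith_pathFlow hH hv ζ)

variable (hH : IsConvexCoerciveHamiltonian H νl νu) (hv : CostDominated H (νl K) v)
include hH hv

lemma isViscositySubsolution_pathFlowMap : IsViscositySubsolution H ζ (pathFlowMap hH hv ζ) :=
  hv.pathFlow_subsolution hH fun _ _ => rfl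

lemma isViscositySupersolution_pathFlowMap :
    IsViscositySupersolution H ζ (pathFlowMap hH hv ζ) := by
  have hsub : IsViscositySubsolution (momentumFlip H) (-ζ) (-pathFlowMap hH hv ζ) :=
    hv.neg.pathFlow_subsolution hH.momentumFlip fun x t => (congrFun (pathFlow_momentumFlip
      (negPart_nonneg _) hH.neg_negPart_le hv ζ t) x).symm
  simpa using hsub.momentumFlip

lemma hasLinearGrowth_pathFlowMap : HasLinearGrowth (pathFlowMap hH hv ζ) := by
  intro T
  obtain ⟨B, hB⟩ :=
    hv.exists_abs_pathFlow_sub_le (negPart_nonneg _) hH.neg_negPart_le ζ T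
  have hlip := (hH.lipschitz_of_costDominated hv).dist_le_mul
  refine ⟨|B| + |v 0| + K, fun x t ht => ?_⟩
  have hflow : |pathFlow H ζ v t x - v x| ≤ |B| := (hB t ht x).trans (le_abs_self B)
  have hdata : |v x - v 0| ≤ K * ‖x‖ := by simpa [Real.dist_eq] using hlip x 0
  have hzero : |pathFlow H ζ v t x| ≤ |B| + K * ‖x‖ + |v 0| := by
    rw [abs_le] at hflow hdata ⊢
    constructor <;> linarith [le_abs_self (v 0), neg_abs_le (v 0)]
  have hnonneg : 0 ≤ (|B| + |v 0|) * ‖x‖ + K := by positivity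
  calc |pathFlow H ζ v t x| ≤ |B| + K * ‖x‖ + |v 0| := hzero
    _ ≤ (|B| + |v 0| + K) * (1 + ‖x‖) := by linarith

variable (hζ : IsPiecewiseC1Path ζ) {u₀ : Space d → ℝ}
include hζ

lemma IsViscositySolution.le_pathFlow (hu : IsViscositySolution H ζ u₀ u) (h : ∀ x, u₀ x ≤ v x)
    (x : Space d) (t : ℝ≥0) : u (x, t) ≤ pathFlow H ζ v t x :=
  comparison_of_lipschitz_supersolution hH hζ hu.subsolution
    (isViscositySupersolution_pathFlowMap hH hv) hu.linear_growth
    (hasLinearGrowth_pathFlowMap hH hv) (lipschitzWith_pathFlow hH hv ζ)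
    (fun x => (hu.initial x).trans_le ((h x).trans_eq (congrFun (pathFlow_zero ζ v) x).symm)) x t

lemma IsViscositySolution.pathFlow_le (hu : IsViscositySolution H ζ u₀ u) (h : ∀ x, v x ≤ u₀ x)
    (x : Space d) (t : ℝ≥0) : pathFlow H ζ v t x ≤ u (x, t) :=
  comparison_of_lipschitz_subsolution hH hζ (isViscositySubsolution_pathFlowMap hH hv)
    hu.supersolution (hasLinearGrowth_pathFlowMap hH hv) hu.linear_growth
    (lipschitzWith_pathFlow hH hv ζ)
    (fun x => (congrFun (pathFlow_zero ζ v) x).trans_le ((h x).trans_eq (hu.initial x).symm)) x t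

lemma IsViscositySolution.abs_sub_pathFlow_le (hu : IsViscositySolution H ζ u₀ u) {ε : ℝ}
    (h : ∀ x, |u₀ x - v x| ≤ ε) (x : Space d) (t : ℝ≥0) :
    |u (x, t) - pathFlow H ζ v t x| ≤ ε := by
  have hm := hH.neg_negPart_le
  have hm0 := negPart_nonneg (νl 0)
  have habove := hu.le_pathFlow hH (hv.add_const ε) hζ
    (fun y => by linarith [(abs_le.1 (h y)).2]) x t
  have hbelow := hu.pathFlow_le hH (hv.add_const (-ε)) hζ
    (fun y => by linarith [(abs_le.1 (h y)).1]) x t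
  have hshift_up := (hv.add_const ε).pathFlow_le_add hm0 hm hv (fun y => le_rfl) ζ t x
  have hshift_down := hv.pathFlow_le_add hm0 hm (hv.add_const (-ε)) (D := ε)
    (fun y => by linarith) ζ t x
  rw [abs_le]
  constructor <;> linarith

lemma IsViscositySolution.eq_pathFlow (hu : IsViscositySolution H ζ v u) (x : Space d) (t : ℝ≥0) :
    u (x, t) = pathFlow H ζ v t x :=
  le_antisymm (hu.le_pathFlow hH hv hζ (fun _ => le_rfl) x t)
    (hu.pathFlow_le hH hv hζ (fun _ => le_rfl) x t)

end SolutionsWithLipschitzData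

section SolutionsWithUniformlyContinuousData

variable {d : ℕ} {H : Space d → Space d → ℝ} {νl νu : ℝ → ℝ} {ζ : C(ℝ≥0, ℝ)}
  {u : C(Space d × ℝ≥0, ℝ)} {w : ℕ → C(Space d × ℝ≥0, ℝ)} {u₀ : Space d → ℝ}

lemma isViscositySupersolution_of_tendstoUniformly
    (hH : Continuous fun q : Space d × Space d => H q.1 q.2)
    (hw : ∀ n, IsViscositySupersolution H ζ (w n))
    (hwu : TendstoUniformly (fun n => w n) u atTop) : IsViscositySupersolution H ζ u := by
  have hsub : IsViscositySubsolution (momentumFlip H) (-ζ) (-u) :=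
    isViscositySubsolution_of_tendstoUniformly (hH.comp (continuous_neg.prodMap continuous_id))
      (fun n => (hw n).momentumFlip) (uniformContinuous_neg.comp_tendstoUniformly hwu)
  simpa using hsub.momentumFlip

lemma IsConvexCoerciveHamiltonian.exists_costDominated_abs_sub_le
    (hH : IsConvexCoerciveHamiltonian H νl νu) (hu : UniformContinuous u₀) {ε : ℝ} (hε : 0 < ε) :
    ∃ (K : ℝ≥0) (v : Space d → ℝ), CostDominated H (νl K) v ∧ ∀ x, |u₀ x - v x| ≤ ε := by
  obtain ⟨L, v, hv, h⟩ := exists_lipschitzWith_abs_sub_le hu hε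
  obtain ⟨K, hK⟩ := hH.exists_lower_eq L
  exact ⟨K, v, hK ▸ hH.costDominated_of_lipschitz hv, h⟩

lemma continuous_extendedFlow (hH : IsConvexCoerciveHamiltonian H νl νu)
    (hu : UniformContinuous u₀) (ζ : C(ℝ≥0, ℝ)) :
    Continuous fun q : Space d × ℝ≥0 => extendedFlow H ζ u₀ q.2 q.1 := by
  refine continuous_of_uniform_approx_of_continuous fun s hs => ?_
  obtain ⟨ε, hε, hεs⟩ := Metric.mem_uniformity_dist.1 hs
  obtain ⟨K, v, hv, h⟩ := hH.exists_costDominated_abs_sub_le hu (half_pos hε)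
  exact ⟨pathFlowMap hH hv ζ, (pathFlowMap hH hv ζ).continuous, fun q => hεs <|
    (abs_extendedFlow_sub_pathFlow_le (negPart_nonneg _) hH.neg_negPart_le hv h q.2 q.1).trans_lt
      (half_lt_self hε)⟩

/-- The solution of the equation with path `ζ` and uniformly continuous initial data `u₀`, as a
function of the path. -/
noncomputable def solutionMap (hH : IsConvexCoerciveHamiltonian H νl νu)
    (hu : UniformContinuous u₀) (ζ : C(ℝ≥0, ℝ)) : C(Space d × ℝ≥0, ℝ) where
  toFun q := extendedFlow H ζ u₀ q.2 q.1
  continuous_toFun := continuous_extendedFlow hH hu ζ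

variable (hH : IsConvexCoerciveHamiltonian H νl νu) (hu₀ : UniformContinuous u₀)

lemma abs_solutionMap_sub_pathFlow_le {c ε : ℝ} {v : Space d → ℝ} (hv : CostDominated H c v)
    (h : ∀ x, |u₀ x - v x| ≤ ε) (x : Space d) (t : ℝ≥0) :
    |solutionMap hH hu₀ ζ (x, t) - pathFlow H ζ v t x| ≤ ε :=
  abs_extendedFlow_sub_pathFlow_le (negPart_nonneg _) hH.neg_negPart_le hv h t x

lemma solutionMap_eq_pathFlow {c : ℝ} (hc : CostDominated H c u₀) (x : Space d) (t : ℝ≥0) :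
    solutionMap hH hu₀ ζ (x, t) = pathFlow H ζ u₀ t x :=
  hc.extendedFlow_eq (negPart_nonneg _) hH.neg_negPart_le t x

lemma solutionMap_initial (x : Space d) : solutionMap hH hu₀ ζ (x, 0) = u₀ x := by
  refine eq_of_abs_sub_le_all fun ε hε => ?_
  obtain ⟨K, v, hv, h⟩ := hH.exists_costDominated_abs_sub_le hu₀ (half_pos hε)
  have hsol := abs_solutionMap_sub_pathFlow_le (ζ := ζ) hH hu₀ hv h x 0
  rw [pathFlow_zero] at hsol
  have hx := h x
  rw [abs_sub_comm] at hx
  linarith [abs_sub_le (solutionMap hH hu₀ ζ (x, 0)) (v x) (u₀ x)]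

lemma hasLinearGrowth_solutionMap : HasLinearGrowth (solutionMap hH hu₀ ζ) := by
  obtain ⟨K, v, hv, h⟩ := hH.exists_costDominated_abs_sub_le hu₀ one_pos
  exact (hasLinearGrowth_pathFlowMap hH hv).of_abs_sub_le fun q =>
    abs_solutionMap_sub_pathFlow_le hH hu₀ hv h q.1 q.2

lemma isViscositySolution_solutionMap :
    IsViscositySolution H ζ u₀ (solutionMap hH hu₀ ζ) := by
  choose K v hv h using fun n : ℕ =>
    hH.exists_costDominated_abs_sub_le hu₀ (Nat.one_div_pos_of_nat (α := ℝ) (n := n))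
  have hlim : TendstoUniformly (fun n => pathFlowMap hH (hv n) ζ) (solutionMap hH hu₀ ζ) atTop := by
    refine Metric.tendstoUniformly_iff.2 fun ε hε => ?_
    filter_upwards [tendsto_one_div_add_atTop_nhds_zero_nat.eventually_lt_const hε] with n hn q
    exact (abs_solutionMap_sub_pathFlow_le hH hu₀ (hv n) (h n) q.1 q.2).trans_lt hn
  exact
    { subsolution := isViscositySubsolution_of_tendstoUniformly hH.continuous_uncurry
        (fun n => isViscositySubsolution_pathFlowMap hH (hv n)) hlim
      supersolution := isViscositySupersolution_of_tendstoUniformly hH.continuous_uncurry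
        (fun n => isViscositySupersolution_pathFlowMap hH (hv n)) hlim
      initial := solutionMap_initial hH hu₀
      linear_growth := hasLinearGrowth_solutionMap hH hu₀ }

lemma IsViscositySolution.eq_solutionMap (hζ : IsPiecewiseC1Path ζ)
    (hu : IsViscositySolution H ζ u₀ u) : u = solutionMap hH hu₀ ζ := by
  ext ⟨x, t⟩
  refine eq_of_abs_sub_le_all fun ε hε => ?_
  obtain ⟨K, v, hv, h⟩ := hH.exists_costDominated_abs_sub_le hu₀ (half_pos hε)
  have husol := hu.abs_sub_pathFlow_le hH hv hζ h x t
  have hsol := abs_solutionMap_sub_pathFlow_le (ζ := ζ) hH hu₀ hv h x t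
  rw [abs_sub_comm] at hsol
  linarith [abs_sub_le (u (x, t)) (pathFlow H ζ v t x) (solutionMap hH hu₀ ζ (x, t))]

end SolutionsWithUniformlyContinuousData

section PathDependence

lemma abs_sub_le_pathDist {ζ₁ ζ₂ : C(ℝ≥0, ℝ)} {T s : ℝ≥0} (hs : s ≤ T) :
    |ζ₁ s - ζ₂ s| ≤ pathDist T ζ₁ ζ₂ :=
  le_csSup (isCompact_Icc.image (ζ₁.continuous.sub ζ₂.continuous).abs).bddAbove
    ⟨s, ⟨zero_le, hs⟩, rfl⟩

variable {E : Type*} [NormedAddCommGroup E] [InnerProductSpace ℝ E] {H : E → E → ℝ}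
  {m c D M : ℝ} {u u₁ u₂ : E → ℝ} {ζ₁ ζ₂ : C(ℝ≥0, ℝ)} {t : ℝ≥0}

lemma discreteFlow_add_const (a : ℕ → ℝ) (D : ℝ) (n : ℕ) (u : E → ℝ) :
    discreteFlow H (fun k => a k + D) n u = discreteFlow H a n u := by
  induction n with
  | zero => rfl
  | succ n ih => simp only [discreteFlow, ih, add_sub_add_right_eq_sub]

lemma pathFlow_add_const (ζ : C(ℝ≥0, ℝ)) (D : ℝ) (u : E → ℝ) :
    pathFlow H (ζ + .const _ D) u = pathFlow H ζ u := by
  have hgrid : gridFlow H (ζ + .const _ D) u = gridFlow H ζ u := by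
    funext n t
    exact discreteFlow_add_const (sample ζ n t) D _ u
  funext t x
  simp only [pathFlow, hgrid]

namespace CostDominated

lemma pathFlow_sub_pathFlow_le (hm0 : 0 ≤ m) (hm : ∀ p x, -m ≤ H p x)
    (hu₁ : CostDominated H c u₁) (hu₂ : CostDominated H c u₂) (hD : ∀ x, |u₁ x - u₂ x| ≤ D)
    (h0 : ζ₁ 0 = ζ₂ 0) (hM : ∀ s ≤ t, |ζ₁ s - ζ₂ s| ≤ M) (x : E) :
    pathFlow H ζ₁ u₁ t x - pathFlow H ζ₂ u₂ t x ≤ D + c * M + m * (M - (ζ₁ t - ζ₂ t)) := by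
  have hdata := hu₁.abs_pathFlow_sub_pathFlow_le hm0 hm hu₂ hD ζ₁ t x
  have hpath := hu₂.pathFlow_le hm0 hm h0 (fun s hs => (le_abs_self _).trans (hM s hs)) x
  linarith [(abs_le.1 hdata).2]

lemma abs_pathFlow_sub_pathFlow_le_of_eq_zero (hm0 : 0 ≤ m) (hm : ∀ p x, -m ≤ H p x)
    (hu₁ : CostDominated H c u₁) (hu₂ : CostDominated H c u₂) (hD : ∀ x, |u₁ x - u₂ x| ≤ D)
    (h0 : ζ₁ 0 = ζ₂ 0) (hM : ∀ s ≤ t, |ζ₁ s - ζ₂ s| ≤ M) (x : E) :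
    |pathFlow H ζ₁ u₁ t x - pathFlow H ζ₂ u₂ t x| ≤ D + c * M + m * (M + |ζ₁ t - ζ₂ t|) := by
  have h₁₂ := hu₁.pathFlow_sub_pathFlow_le hm0 hm hu₂ hD h0 hM x
  have h₂₁ := hu₂.pathFlow_sub_pathFlow_le hm0 hm hu₁ (fun x => abs_sub_comm (u₁ x) _ ▸ hD x)
    h0.symm (fun s hs => abs_sub_comm (ζ₁ s) _ ▸ hM s hs) x
  have hneg := mul_le_mul_of_nonneg_left (neg_le_abs (ζ₁ t - ζ₂ t)) hm0
  have hpos := mul_le_mul_of_nonneg_left (le_abs_self (ζ₁ t - ζ₂ t)) hm0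
  rw [abs_sub_le_iff]
  constructor <;> linarith

-- Only increments of the path matter, so translating `ζ₂` reduces to equal initial values, at the
-- cost of doubling `M`.
lemma abs_pathFlow_sub_pathFlow_le_of_path (hm0 : 0 ≤ m) (hm : ∀ p x, -m ≤ H p x)
    (hu : CostDominated H c u) (hM : ∀ s ≤ t, |ζ₁ s - ζ₂ s| ≤ M) (x : E) :
    |pathFlow H ζ₁ u t x - pathFlow H ζ₂ u t x| ≤ 2 * (c + 2 * m) * M := by
  set η := ζ₂ + .const _ (ζ₁ 0 - ζ₂ 0) with hη
  have hη_apply : ∀ s, ζ₁ s - η s = ζ₁ s - ζ₂ s - (ζ₁ 0 - ζ₂ 0) := fun s => sub_add_eq_sub_sub ..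
  have hηM : ∀ s ≤ t, |ζ₁ s - η s| ≤ 2 * M := fun s hs => by
    rw [hη_apply, two_mul]
    exact (abs_sub _ _).trans (add_le_add (hM s hs) (hM 0 zero_le))
  have h0 : ζ₁ 0 = η 0 := by rw [← sub_eq_zero, hη_apply, sub_self]
  calc |pathFlow H ζ₁ u t x - pathFlow H ζ₂ u t x|
      = |pathFlow H ζ₁ u t x - pathFlow H η u t x| := by rw [hη, pathFlow_add_const]
    _ ≤ 0 + c * (2 * M) + m * (2 * M + |ζ₁ t - η t|) :=
        hu.abs_pathFlow_sub_pathFlow_le_of_eq_zero hm0 hm hu (by simp) h0 hηM x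
    _ ≤ 0 + c * (2 * M) + m * (2 * M + 2 * M) := by gcongr; exact hηM t le_rfl
    _ = 2 * (c + 2 * m) * M := by ring

end CostDominated

end PathDependence

section LocallyUniformConvergence

lemma IsC1Path.isPiecewiseC1Path {ζ : C(ℝ≥0, ℝ)} (hζ : IsC1Path ζ) : IsPiecewiseC1Path ζ := by
  intro t ht
  rcases ht.eq_or_lt with rfl | ht
  · exact ⟨1, one_pos, hζ.mono fun r hr => hr.1, fun h => absurd h (lt_irrefl _)⟩
  · exact ⟨t, ht, hζ.mono fun r hr => ht.le.trans hr.1,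
      fun _ => hζ.mono fun r hr => (sub_self t).ge.trans hr.1⟩

lemma isC1Path_polynomial (p : Polynomial ℝ) :
    IsC1Path ⟨fun t => p.eval (t : ℝ), by fun_prop⟩ := by
  have hsmooth : ContDiff ℝ 1 fun t : ℝ => p.eval t := by simpa using p.contDiff_aeval (𝕜 := ℝ) 1
  refine hsmooth.contDiffOn.congr fun t ht => ?_
  simp only [pathExt, ContinuousMap.coe_mk, Real.coe_toNNReal t ht]

lemma eventually_forall_le_abs_sub_le (ζ : C(ℝ≥0, ℝ)) (T : ℝ≥0) {ω : ℝ} (hω : 0 < ω) :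
    ∀ᶠ η : C(ℝ≥0, ℝ) in 𝓝 ζ, ∀ s ≤ T, |ζ s - η s| ≤ ω := by
  have hunif := ContinuousMap.tendsto_iff_forall_isCompact_tendstoUniformlyOn.1
    (tendsto_id (x := 𝓝 ζ)) _ (isCompact_Icc (a := (0 : ℝ≥0)) (b := T))
  filter_upwards [Metric.tendstoUniformlyOn_iff.1 hunif ω hω] with η hη s hs
  exact (hη s ⟨zero_le, hs⟩).le

lemma tendsto_of_forall_le_abs_sub_lt {ζ : C(ℝ≥0, ℝ)} {η : ℕ → C(ℝ≥0, ℝ)}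
    (h : ∀ n : ℕ, ∀ t ≤ (n : ℝ≥0), |η n t - ζ t| < 1 / ((n : ℝ) + 1)) :
    Tendsto η atTop (𝓝 ζ) := by
  refine ContinuousMap.tendsto_iff_forall_isCompact_tendstoUniformlyOn.2 fun Q hQ =>
    Metric.tendstoUniformlyOn_iff.2 fun ε hε => ?_
  obtain ⟨R, hR⟩ := hQ.bddAbove
  obtain ⟨N, hN⟩ := exists_nat_ge R
  filter_upwards [tendsto_one_div_add_atTop_nhds_zero_nat.eventually_lt_const hε,
    eventually_ge_atTop N] with n hn hnN t ht
  have htn : t ≤ n := (hR ht).trans (hN.trans (by exact_mod_cast hnN))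
  rw [dist_comm, Real.dist_eq]
  exact (h n t htn).trans hn

lemma dense_isC1Path : Dense {ζ : C(ℝ≥0, ℝ) | IsC1Path ζ} := by
  intro ζ
  choose p hp using fun n : ℕ => exists_polynomial_near_of_continuousOn 0 n (pathExt ζ)
    (ζ.continuous.comp continuous_real_toNNReal).continuousOn _
    (Nat.one_div_pos_of_nat (α := ℝ) (n := n))
  refine mem_closure_of_tendsto (tendsto_of_forall_le_abs_sub_lt fun n t ht => ?_)
    (.of_forall fun n => isC1Path_polynomial (p n))
  simpa only [ContinuousMap.coe_mk, pathExt, Real.toNNReal_coe] using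
    hp n t ⟨t.2, by exact_mod_cast ht⟩

end LocallyUniformConvergence

section SolutionOperator

variable {d : ℕ} {H : Space d → Space d → ℝ} {νl νu : ℝ → ℝ} {u₀ : Space d → ℝ}
  {S : C(ℝ≥0, ℝ) → C(Space d × ℝ≥0, ℝ)} {ζ : C(ℝ≥0, ℝ)} {u : C(Space d × ℝ≥0, ℝ)}
  (hH : IsConvexCoerciveHamiltonian H νl νu) (hu₀ : UniformContinuous u₀)

lemma continuous_solutionMap : Continuous (solutionMap hH hu₀) := by
  refine continuous_iff_continuousAt.2 fun ζ =>
    ContinuousMap.tendsto_iff_forall_isCompact_tendstoUniformlyOn.2 fun Q hQ =>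
      Metric.tendstoUniformlyOn_iff.2 fun ε hε => ?_
  obtain ⟨K, v, hv, hv₀⟩ := hH.exists_costDominated_abs_sub_le hu₀ (by positivity : 0 < ε / 4)
  obtain ⟨T, hT⟩ := (hQ.image continuous_snd).bddAbove
  obtain ⟨ω, hω, hωε⟩ := exists_pos_mul_lt (half_pos hε) (2 * (νl K + 2 * (νl 0)⁻))
  filter_upwards [eventually_forall_le_abs_sub_le ζ T hω] with η hη ⟨x, t⟩ hq
  have htT : t ≤ T := hT ⟨_, hq, rfl⟩
  have hζv := abs_solutionMap_sub_pathFlow_le (ζ := ζ) hH hu₀ hv hv₀ x t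
  have hηv := abs_solutionMap_sub_pathFlow_le (ζ := η) hH hu₀ hv hv₀ x t
  have hpath := hv.abs_pathFlow_sub_pathFlow_le_of_path (negPart_nonneg _) hH.neg_negPart_le
    (fun s hs => hη s (hs.trans htT)) x
  rw [Real.dist_eq, abs_lt]
  rw [abs_le] at hζv hηv hpath
  constructor <;> linarith

lemma isSolutionOperator_solutionMap : IsSolutionOperator H u₀ (solutionMap hH hu₀) :=
  ⟨continuous_solutionMap hH hu₀, fun _ _ => isViscositySolution_solutionMap hH hu₀⟩

lemma IsSolutionOperator.eq_solutionMap (hS : IsSolutionOperator H u₀ S) :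
    S = solutionMap hH hu₀ :=
  Continuous.ext_on dense_isC1Path hS.1 (continuous_solutionMap hH hu₀) fun ζ hζ =>
    (hS.2 ζ hζ).eq_solutionMap hH hu₀ (IsC1Path.isPiecewiseC1Path hζ)

lemma isViscositySolution_iff_eq_solutionMap (hζ : IsPiecewiseC1Path ζ) :
    IsViscositySolution H ζ u₀ u ↔ u = solutionMap hH hu₀ ζ :=
  ⟨fun hu => hu.eq_solutionMap hH hu₀ hζ, fun hu => hu ▸ isViscositySolution_solutionMap hH hu₀⟩

end SolutionOperator

theorem theoremT {d : ℕ} (H : Space d → Space d → ℝ) (νl νu : ℝ → ℝ)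
    (hH : IsConvexCoerciveHamiltonian H νl νu) :
    -- estimates for the viscosity solutions driven by piecewise `C¹` paths;
    -- `K` is the value at `νu L` of the inverse function of `νl`
    (∀ (L : ℝ≥0), ∃ K : ℝ≥0, νl K = νu L ∧
      ∀ (u₀₁ u₀₂ : Space d → ℝ), LipschitzWith L u₀₁ → LipschitzWith L u₀₂ →
      ∀ (ζ₁ ζ₂ : C(ℝ≥0, ℝ)), IsPiecewiseC1Path ζ₁ → IsPiecewiseC1Path ζ₂ →
      ∀ (u₁ u₂ : C(Space d × ℝ≥0, ℝ)),
        IsViscositySolution H ζ₁ u₀₁ u₁ → IsViscositySolution H ζ₂ u₀₂ u₂ →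
        (∀ t : ℝ≥0, LipschitzWith K (fun x => u₁ (x, t)) ∧ LipschitzWith K (fun x => u₂ (x, t))) ∧
        (ζ₁ 0 = ζ₂ 0 → ∀ D : ℝ, (∀ x, |u₀₁ x - u₀₂ x| ≤ D) →
          ∀ (T t : ℝ≥0), t ≤ T → ∀ x : Space d,
            u₁ (x, t) - u₂ (x, t) ≤ D + νu L * pathDist T ζ₁ ζ₂
              + (νl 0)⁻ * (pathDist T ζ₁ ζ₂ - (ζ₁ t - ζ₂ t)) ∧
            |u₁ (x, t) - u₂ (x, t)| ≤ D + νu L * pathDist T ζ₁ ζ₂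
              + (νl 0)⁻ * (pathDist T ζ₁ ζ₂ + |ζ₁ t - ζ₂ t|))) ∧
    -- well-posedness and unique continuous extension to continuous paths
    (∀ u₀ : Space d → ℝ, UniformContinuous u₀ →
      (∃! S : C(ℝ≥0, ℝ) → C(Space d × ℝ≥0, ℝ), IsSolutionOperator H u₀ S) ∧
      ∀ S : C(ℝ≥0, ℝ) → C(Space d × ℝ≥0, ℝ), IsSolutionOperator H u₀ S →
        ∀ ζ, IsPiecewiseC1Path ζ → ∀ u, IsViscositySolution H ζ u₀ u ↔ u = S ζ) ∧
    -- estimates for the extended solution operator, for arbitrary continuous paths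
    (∀ (L : ℝ≥0), ∃ K : ℝ≥0, νl K = νu L ∧
      ∀ u₀ : Space d → ℝ, LipschitzWith L u₀ →
      ∀ S : C(ℝ≥0, ℝ) → C(Space d × ℝ≥0, ℝ), IsSolutionOperator H u₀ S →
        (∀ ζ, ∀ t : ℝ≥0, LipschitzWith K (fun x => S ζ (x, t))) ∧
        (∀ (ζ₁ ζ₂ : C(ℝ≥0, ℝ)) (T t : ℝ≥0), t ≤ T → ∀ x : Space d,
          |S ζ₁ (x, t) - S ζ₂ (x, t)| ≤
            2 * (νu L + 2 * (νl 0)⁻) * pathDist T ζ₁ ζ₂)) := by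
  have hm := hH.neg_negPart_le
  have hm0 := negPart_nonneg (νl 0)
  refine ⟨fun L => ?_, fun u₀ hu₀ => ⟨?_, fun S hS ζ hζ u => ?_⟩, fun L => ?_⟩
  · obtain ⟨K, hK⟩ := hH.exists_lower_eq L
    refine ⟨K, hK, fun u₀₁ u₀₂ hu₀₁ hu₀₂ ζ₁ ζ₂ hζ₁ hζ₂ u₁ u₂ hu₁ hu₂ => ?_⟩
    have hc₁ : CostDominated H (νl K) u₀₁ := hK ▸ hH.costDominated_of_lipschitz hu₀₁
    have hc₂ : CostDominated H (νl K) u₀₂ := hK ▸ hH.costDominated_of_lipschitz hu₀₂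
    simp only [hu₁.eq_pathFlow hH hc₁ hζ₁, hu₂.eq_pathFlow hH hc₂ hζ₂, ← hK]
    refine ⟨fun t => ⟨lipschitzWith_pathFlow hH hc₁ ζ₁ t, lipschitzWith_pathFlow hH hc₂ ζ₂ t⟩,
      fun h0 D hD T t ht x => ?_⟩
    have hM := fun s (hs : s ≤ t) => abs_sub_le_pathDist (ζ₁ := ζ₁) (ζ₂ := ζ₂) (hs.trans ht)
    exact ⟨hc₁.pathFlow_sub_pathFlow_le hm0 hm hc₂ hD h0 hM x,
      hc₁.abs_pathFlow_sub_pathFlow_le_of_eq_zero hm0 hm hc₂ hD h0 hM x⟩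
  · exact ⟨_, isSolutionOperator_solutionMap hH hu₀, fun S hS => hS.eq_solutionMap hH hu₀⟩
  · exact hS.eq_solutionMap hH hu₀ ▸ isViscositySolution_iff_eq_solutionMap hH hu₀ hζ
  · obtain ⟨K, hK⟩ := hH.exists_lower_eq L
    refine ⟨K, hK, fun u₀ hu₀ S hS => ?_⟩
    have hc : CostDominated H (νl K) u₀ := hK ▸ hH.costDominated_of_lipschitz hu₀
    simp only [hS.eq_solutionMap hH hu₀.uniformContinuous,
      solutionMap_eq_pathFlow hH hu₀.uniformContinuous hc, ← hK]
    exact ⟨lipschitzWith_pathFlow hH hc, fun ζ₁ ζ₂ T t ht x =>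
      hc.abs_pathFlow_sub_pathFlow_le_of_path hm0 hm
        (fun s hs => abs_sub_le_pathDist (hs.trans ht)) x⟩
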